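/- Let $a,b,c,d,e$ be real numbers with $b<0$, $c>0$, $d>0$, $e>0$, $a^2+bc<0$, and let $Z_\varepsilon=(Z_\varepsilon^+,Z_\varepsilon^-)$, $\varepsilon>0$, be a family of planar piecewise linear vector fields with switching line $\Sigma=\{x=0\}$ ($Z^+_\varepsilon$ acts on $x\ge 0$, $Z^-_\varepsilon$ on $x\le 0$), of the form $$Z^{\pm}_\varepsilon(p)=\big(A^\pm+\varepsilon B^\pm+\varepsilon^2C^\pm+\mathcal O(\varepsilon^3)\big)p+u^\pm+\varepsilon v^\pm+\varepsilon^2w^\pm+\mathcal O(\varepsilon^3)\qquad(\varepsilon\to0^+),$$ $$A^+=\begin{pmatrix}a&b\\c&-a\end{pmatrix},\quad A^-=\begin{pmatrix}0&-1\\1&0\end{pmatrix},\quad u^+=\begin{pmatrix}0\\d\end{pmatrix},\quad u^-=\begin{pmatrix}0\\e\end{pmatrix},$$ where $B^\pm=(b^\pm_{ij})$, $C^\pm=(c^\pm_{ij})$ are arbitrary real $2\times2$ matrices and $v^\pm=(v^\pm_1,v^\pm_2)$, $w^\pm$ arbitrary vectors, and the remainders do not depend on $p$. (This is the canonical form of a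 second-order piecewise linear perturbation of a piecewise linear system with a global center that is a real center for $Z_0^-$, while $Z_0^+$ has a virtual center.) For $p\in\Sigma$ let $Z^\pm h(p)$ be the first component of $Z^\pm(p)$. The sliding region is $\Sigma^s=\{p\in\Sigma: Z^+h<0<Z^-h\}$, the escaping region is $\Sigma^e=\{p\in\Sigma: Z^-h<0<Z^+h\}$, and on both one has the sliding vector field $Z^s=\dfrac{Z^-h\,Z^+-Z^+h\,Z^-}{Z^-h-Z^+h}$. A sliding (escaping) cycle is a closed trajectory that is a concatenation of finitely many orbit arcs of $Z^+$ in $x>0$, of $Z^-$ in $x<0$ and of $Z^s$, with at least one arc of $Z^s$ in $\Sigma^s$ (in $\Sigma^e$) and at least one arc of $Z^+$ or $Z^-$. It is of Type I if it contains arcs of exactly one of $Z^+,Z^-$, and of Type II if it contains arcs of both. Put $$K=\frac{(v_1^-b+v_1^+)^2}{b^2e^2\pi}.$$ Then the following hold for all sufficiently small $\varepsilon>0$. (1) Suppose $b_{11}^-=-b_{22}^-$, $bv_1^-+v_1^+<0$ and $0<a<d+be$. (a) If $0<c_{11}^-+c_{22}^-<\tfrac12K$, then $Z_\varepsilon$ admits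 a sliding cycle of Type I. (b) If $\tfrac12K<c_{11}^-+c_{22}^-<2K$, then $Z_\varepsilon$ admits a sliding cycle of Type II. (2) Suppose $b_{11}^-=-b_{22}^-$, $bv_1^-+v_1^+>0$, $a<0$ and $d+be>0$. (a) If $-\tfrac12K<c_{11}^-+c_{22}^-<0$, then $Z_\varepsilon$ admits an escaping cycle of Type I. (b) If $-2K<c_{11}^-+c_{22}^-<-\tfrac12K$, then $Z_\varepsilon$ admits an escaping cycle of Type II. The cycles in (1) and (2) are simple closed curves, and all their arcs of $Z^s$ lie in $\Sigma^s$ in case (1) and in $\Sigma^e$ in case (2). (3) If $b_{11}^-\ne-b_{22}^-$, then $Z_\varepsilon$ admits neither a sliding nor an escaping cycle. -/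

import Mathlib

open Set Filter Topology Asymptotics
open scoped Matrix

/-- A piecewise affine planar vector field with switching line `Σ = {x = 0}`:
`Z⁺(p) = Mp p + up` on the right, `Z⁻(p) = Mm p + um` on the left.
A point is `p : Fin 2 → ℝ` with `x = p 0` and `y = p 1`. -/
structure PLField where
  Mp : Matrix (Fin 2) (Fin 2) ℝ
  up : Fin 2 → ℝ
  Mm : Matrix (Fin 2) (Fin 2) ℝ
  um : Fin 2 → ℝ

namespace PLField

/-- The right vector field `Z⁺`. -/
def plus (Z : PLField) (p : Fin 2 → ℝ) : Fin 2 → ℝ := Z.Mp *ᵥ p + Z.up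

/-- The left vector field `Z⁻`. -/
def minus (Z : PLField) (p : Fin 2 → ℝ) : Fin 2 → ℝ := Z.Mm *ᵥ p + Z.um

/-- The sliding region `Σˢ`. For `h(x, y) = x` the Lie derivative `Z^± h` is the first
coordinate of `Z^±`. -/
def slidingRegion (Z : PLField) : Set (Fin 2 → ℝ) :=
  {p | p 0 = 0 ∧ Z.plus p 0 < 0 ∧ 0 < Z.minus p 0}

/-- The escaping region `Σᵉ`. -/
def escapingRegion (Z : PLField) : Set (Fin 2 → ℝ) :=
  {p | p 0 = 0 ∧ 0 < Z.plus p 0 ∧ Z.minus p 0 < 0}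

/-- Filippov's sliding vector field
`Zˢ = (Z⁻h Z⁺ - Z⁺h Z⁻) / (Z⁻h - Z⁺h)`; it is used on `Σˢ ∪ Σᵉ` only, where the
denominator does not vanish. -/
noncomputable def slide (Z : PLField) (p : Fin 2 → ℝ) : Fin 2 → ℝ :=
  (Z.minus p 0 - Z.plus p 0)⁻¹ • (Z.minus p 0 • Z.plus p - Z.plus p 0 • Z.minus p)

end PLField

/-- The four kinds of arcs of a trajectory: orbits of `Z⁺` in `x > 0`, orbits of `Z⁻` in
`x < 0`, orbits of `Zˢ` in the sliding region, orbits of `Zˢ` in the escaping region. -/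
inductive ArcKind where
  | plus
  | minus
  | sliding
  | escaping

/-- The part of the plane in which an arc of the given kind runs. -/
def ArcKind.region (Z : PLField) : ArcKind → Set (Fin 2 → ℝ)
  | .plus => {p | 0 < p 0}
  | .minus => {p | p 0 < 0}
  | .sliding => Z.slidingRegion
  | .escaping => Z.escapingRegion

/-- The vector field which an arc of the given kind follows. -/
noncomputable def ArcKind.field (Z : PLField) : ArcKind → (Fin 2 → ℝ) → (Fin 2 → ℝ)
  | .plus => Z.plus
  | .minus => Z.minus
  | .sliding => Z.slide
  | .escaping => Z.slide

/-- A closed trajectory of `Z` by Filippov's convention: a continuous closed curve which is a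
concatenation of finitely many arcs, the `i`-th one running over the open time interval
`(time i, time (i + 1))` in the region of its kind and solving there the ODE of its kind. -/
structure ClosedTrajectory (Z : PLField) where
  n : ℕ
  n_pos : 0 < n
  time : Fin (n + 1) → ℝ
  time_strictMono : StrictMono time
  kind : Fin n → ArcKind
  curve : ℝ → Fin 2 → ℝ
  continuousOn : ContinuousOn curve (Icc (time 0) (time (Fin.last n)))
  closed : curve (time 0) = curve (time (Fin.last n))
  mem_region : ∀ i, ∀ t ∈ Ioo (time i.castSucc) (time i.succ),
    curve t ∈ (kind i).region Z
  hasDerivAt : ∀ i, ∀ t ∈ Ioo (time i.castSucc) (time i.succ),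
    HasDerivAt curve ((kind i).field Z (curve t)) t

namespace ClosedTrajectory

variable {Z : PLField}

/-- The trajectory contains an arc of kind `k`. -/
def Uses (γ : ClosedTrajectory Z) (k : ArcKind) : Prop := ∃ i, γ.kind i = k

/-- The curve is a simple closed curve, run through once. -/
def IsSimple (γ : ClosedTrajectory Z) : Prop :=
  InjOn γ.curve (Ico (γ.time 0) (γ.time (Fin.last γ.n)))

/-- A sliding cycle: composed of arcs of `Zˢ`, at least one of them in the sliding region,
and of arcs of `Z⁺` and/or `Z⁻`. -/
def IsSlidingCycle (γ : ClosedTrajectory Z) : Prop :=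
  γ.Uses .sliding ∧ (γ.Uses .plus ∨ γ.Uses .minus)

/-- An escaping cycle: composed of arcs of `Zˢ`, at least one of them in the escaping region,
and of arcs of `Z⁺` and/or `Z⁻`. -/
def IsEscapingCycle (γ : ClosedTrajectory Z) : Prop :=
  γ.Uses .escaping ∧ (γ.Uses .plus ∨ γ.Uses .minus)

/-- Type I: besides arcs of `Zˢ` there are arcs of exactly one of `Z⁺`, `Z⁻`. -/
def IsTypeI (γ : ClosedTrajectory Z) : Prop :=
  (γ.Uses .plus ∧ ¬ γ.Uses .minus) ∨ (γ.Uses .minus ∧ ¬ γ.Uses .plus)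

/-- Type II: besides arcs of `Zˢ` there are arcs of both `Z⁺` and `Z⁻`. -/
def IsTypeII (γ : ClosedTrajectory Z) : Prop := γ.Uses .plus ∧ γ.Uses .minus

/-- A simple sliding cycle all of whose arcs of `Zˢ` lie in the sliding region. -/
def IsProperSlidingCycle (γ : ClosedTrajectory Z) : Prop :=
  γ.IsSimple ∧ γ.IsSlidingCycle ∧ ¬ γ.Uses .escaping

/-- A simple escaping cycle all of whose arcs of `Zˢ` lie in the escaping region. -/
def IsProperEscapingCycle (γ : ClosedTrajectory Z) : Prop :=
  γ.IsSimple ∧ γ.IsEscapingCycle ∧ ¬ γ.Uses .sliding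

end ClosedTrajectory

/-- `M(ε) = A + ε B + ε² C + O(ε³)` as `ε → 0⁺`, for matrices, entry by entry. -/
def MatrixExpansion (M : ℝ → Matrix (Fin 2) (Fin 2) ℝ) (A B C : Matrix (Fin 2) (Fin 2) ℝ) :
    Prop :=
  ∀ i j, (fun ε : ℝ => M ε i j - (A i j + ε * B i j + ε ^ 2 * C i j))
    =O[𝓝[>] 0] (fun ε : ℝ => ε ^ 3)

/-- `u(ε) = u₀ + ε v + ε² w + O(ε³)` as `ε → 0⁺`, for vectors, entry by entry. -/
def VectorExpansion (u : ℝ → Fin 2 → ℝ) (u₀ v w : Fin 2 → ℝ) : Prop :=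
  ∀ i, (fun ε : ℝ => u ε i - (u₀ i + ε * v i + ε ^ 2 * w i))
    =O[𝓝[>] 0] (fun ε : ℝ => ε ^ 3)

/-!
Everything is explicit because the abscissa `x` of an orbit of either affine field is a damped
oscillator `x'' = 2 α x' - (α ^ 2 + ω ^ 2) x + κ` with `κ < 0`. On the switching line the normal
velocity `x'` is proportional to the distance from the fold, the point where the field is tangent to
the line. The fold of `Z⁻` is visible, that of `Z⁺` invisible, and their distance `δ` is of order
`ε`. Between the folds lies the sliding region or the escaping region, according to the sign of `δ`.

*Existence of sliding cycles.* The orbit of `Z⁻` through its fold turns round the focus and returns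
with a speed `w` that depends on the angle `2 π - s` through which it has turned, where
`exp (k (2 π - s)) (cos s + k sin s) = 1` with `k = α / ω`. As `k → 0⁺` one gets `sin s ^ 2 ∼ 4 π k`
(`exists_return_angle_asymptotics`), so that `w` is asymptotic to `ε e √(2 π (c₁₁⁻ + c₂₂⁻))`
(`PerturbedCenter.exists_slidingPair`). If `w` is less than the value that corresponds to `δ`, the
orbit lands in the sliding region, and there the sliding vector field carries it up to the fold of
`Z⁻`: a cycle of Type I. If `w` lies between this value and its double, the orbit lands below the
fold of `Z⁺`, near which an excursion of `Z⁺` is almost a reflection; it takes the orbit into the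
sliding region: a cycle of Type II. That excursions of `Z⁺` change the speed only by a factor close
to `1` follows from the energy balance `E' = 2 α x' ^ 2` (`Oscillator.landing_of_pos`).

*Escaping cycles.* Reversal of time combined with the reflection of `y` preserves the canonical
form, exchanges sliding and escaping, and changes the signs of the traces and of `δ`.

*Nonexistence.* If the trace of `Z⁻` is of order `ε`, time reversal allows one to assume that it is
positive. By the energy balance every excursion of `Z⁻` that returns to the switching line then does
so with a speed at least of order `√ε` (`Oscillator.landing_of_neg`), that is, far below the folds
compared with their distance; the next excursion of `Z⁺` loses at most half of that distance and
ends above the folds. Hence an orbit that has once left the segment between the folds never comes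
back to it (`PLField.IsRepelling.trap_step`), and a closed trajectory with a sliding or an escaping
arc consists of such arcs only.
-/

/-! ### Damped oscillators -/

/-- A solution of the damped oscillator `x'' = 2 α x' - (α ^ 2 + ω ^ 2) x + κ`, written as a
first order system in the position `x` and the velocity `v`. -/
structure Oscillator (α ω κ : ℝ) (x v : ℝ → ℝ) : Prop where
  dx : ∀ t, HasDerivAt x (v t) t
  dv : ∀ t, HasDerivAt v (2 * α * v t - (α ^ 2 + ω ^ 2) * x t + κ) t

namespace Oscillator

variable {α ω κ : ℝ} {x v : ℝ → ℝ}

theorem continuous_x (h : Oscillator α ω κ x v) : Continuous x :=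
  continuous_iff_continuousAt.2 fun t => (h.dx t).continuousAt

theorem sq_add_sq_pos (hω : 0 < ω) : 0 < α ^ 2 + ω ^ 2 := by positivity

theorem hasDerivAt_exp_mul (α t : ℝ) :
    HasDerivAt (fun t => Real.exp (α * t)) (Real.exp (α * t) * α) t := by
  simpa using ((hasDerivAt_id t).const_mul α).exp

theorem hasDerivAt_cos_mul (ω t : ℝ) :
    HasDerivAt (fun t => Real.cos (ω * t)) (-Real.sin (ω * t) * ω) t := by
  simpa using ((hasDerivAt_id t).const_mul ω).cos

theorem hasDerivAt_sin_mul (ω t : ℝ) :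
    HasDerivAt (fun t => Real.sin (ω * t)) (Real.cos (ω * t) * ω) t := by
  simpa using ((hasDerivAt_id t).const_mul ω).sin

/-- Explicit solution of the homogeneous equation. -/
theorem homogeneous_eq (h : Oscillator α ω 0 x v) (hω : 0 < ω) (t : ℝ) :
    x t = Real.exp (α * t) *
      (x 0 * Real.cos (ω * t) + (v 0 - α * x 0) / ω * Real.sin (ω * t)) := by
  -- the two coefficients in the rotating frame are constants of motion
  have h1 : ∀ s, HasDerivAt (fun t => Real.exp (-α * t) *
      (x t * Real.cos (ω * t) - (v t - α * x t) / ω * Real.sin (ω * t))) 0 s := by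
    intro s
    refine HasDerivAt.congr_deriv ((hasDerivAt_exp_mul (-α) s).mul
      (((h.dx s).mul (hasDerivAt_cos_mul ω s)).sub
        ((((h.dv s).sub ((h.dx s).const_mul α)).div_const ω).mul (hasDerivAt_sin_mul ω s)))) ?_
    simp only [Pi.sub_apply]
    field_simp
    ring
  have h2 : ∀ s, HasDerivAt (fun t => Real.exp (-α * t) *
      (x t * Real.sin (ω * t) + (v t - α * x t) / ω * Real.cos (ω * t))) 0 s := by
    intro s
    refine HasDerivAt.congr_deriv ((hasDerivAt_exp_mul (-α) s).mul
      (((h.dx s).mul (hasDerivAt_sin_mul ω s)).add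
        ((((h.dv s).sub ((h.dx s).const_mul α)).div_const ω).mul (hasDerivAt_cos_mul ω s)))) ?_
    simp only [Pi.sub_apply]
    field_simp
    ring
  have e1 := is_const_of_deriv_eq_zero (fun s => (h1 s).differentiableAt)
    (fun s => (h1 s).deriv) t 0
  have e2 := is_const_of_deriv_eq_zero (fun s => (h2 s).differentiableAt)
    (fun s => (h2 s).deriv) t 0
  simp only [mul_zero, Real.exp_zero, Real.cos_zero, Real.sin_zero, one_mul, mul_one, sub_zero,
    zero_add] at e1 e2
  have he : Real.exp (α * t) * Real.exp (-α * t) = 1 := by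
    rw [← Real.exp_add]; simp
  have hcs := Real.sin_sq_add_cos_sq (ω * t)
  rw [← e2, ← e1]
  linear_combination (-x t) * he - x t * Real.exp (α * t) * Real.exp (-α * t) * hcs

/-- The velocity solves the homogeneous equation. -/
theorem velocity (h : Oscillator α ω κ x v) :
    Oscillator α ω 0 v (fun t => 2 * α * v t - (α ^ 2 + ω ^ 2) * x t + κ) where
  dx := h.dv
  dv t := by
    refine HasDerivAt.congr_deriv
      ((((h.dv t).const_mul (2 * α)).sub ((h.dx t).const_mul (α ^ 2 + ω ^ 2))).add_const κ) ?_
    ring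

/-- The displacement from equilibrium solves the homogeneous equation. -/
theorem displacement (h : Oscillator α ω κ x v) (hω : 0 < ω) :
    Oscillator α ω 0 (fun t => x t - κ / (α ^ 2 + ω ^ 2)) v where
  dx t := (h.dx t).sub_const _
  dv t := by
    refine (h.dv t).congr_deriv ?_
    have := (sq_add_sq_pos (α := α) hω).ne'
    field_simp
    ring

theorem exists_solution (α κ : ℝ) {ω : ℝ} (hω : 0 < ω) (x₀ v₀ : ℝ) :
    ∃ x v, Oscillator α ω κ x v ∧ x 0 = x₀ ∧ v 0 = v₀ := by
  set c := κ / (α ^ 2 + ω ^ 2) with hc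
  set A := x₀ - c with hA
  set B := (v₀ - α * A) / ω with hB
  have hne := (sq_add_sq_pos (α := α) hω).ne'
  have hc' : (α ^ 2 + ω ^ 2) * c = κ := by rw [hc]; field_simp
  have hB' : ω * B = v₀ - α * A := by rw [hB]; field_simp
  refine ⟨fun t => c + Real.exp (α * t) * (A * Real.cos (ω * t) + B * Real.sin (ω * t)),
    fun t => Real.exp (α * t) * ((α * A + ω * B) * Real.cos (ω * t)
      + (α * B - ω * A) * Real.sin (ω * t)), ⟨fun t => ?_, fun t => ?_⟩, ?_, ?_⟩
  · refine HasDerivAt.congr_deriv (((hasDerivAt_exp_mul α t).mul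
      (((hasDerivAt_cos_mul ω t).const_mul A).add
        ((hasDerivAt_sin_mul ω t).const_mul B))).const_add c) ?_
    simp only [Pi.add_apply]
    ring
  · refine HasDerivAt.congr_deriv ((hasDerivAt_exp_mul α t).mul
      (((hasDerivAt_cos_mul ω t).const_mul (α * A + ω * B)).add
        ((hasDerivAt_sin_mul ω t).const_mul (α * B - ω * A)))) ?_
    linear_combination hc'
  · simp [hA]
  · simp [hB']

/-- Balance of energy: the damping does the work `2 α v ^ 2`. -/
theorem hasDerivAt_energy (h : Oscillator α ω κ x v) (t : ℝ) :
    HasDerivAt (fun t => v t ^ 2 / 2 + (α ^ 2 + ω ^ 2) * x t ^ 2 / 2 - κ * x t)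
      (2 * α * v t ^ 2) t := by
  refine HasDerivAt.congr_deriv (((((h.dv t).pow 2).div_const 2 |>.add
    ((((h.dx t).pow 2).const_mul (α ^ 2 + ω ^ 2)).div_const 2)).sub ((h.dx t).const_mul κ))) ?_
  push_cast
  ring

/-- After one turn the displacement from equilibrium is multiplied by a constant. -/
theorem displacement_full_turn (h : Oscillator α ω κ x v) (hω : 0 < ω) :
    x (2 * Real.pi / ω) - κ / (α ^ 2 + ω ^ 2)
      = Real.exp (2 * Real.pi * α / ω) * (x 0 - κ / (α ^ 2 + ω ^ 2)) := by
  have := (h.displacement hω).homogeneous_eq hω (2 * Real.pi / ω)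
  have e1 : ω * (2 * Real.pi / ω) = 2 * Real.pi := by field_simp
  have e2 : α * (2 * Real.pi / ω) = 2 * Real.pi * α / ω := by ring
  simpa [e1, e2] using this

theorem displacement_half_turn (h : Oscillator α ω κ x v) (hω : 0 < ω) :
    x (Real.pi / ω) - κ / (α ^ 2 + ω ^ 2)
      = -(Real.exp (Real.pi * α / ω) * (x 0 - κ / (α ^ 2 + ω ^ 2))) := by
  have := (h.displacement hω).homogeneous_eq hω (Real.pi / ω)
  have e1 : ω * (Real.pi / ω) = Real.pi := by field_simp
  have e2 : α * (Real.pi / ω) = Real.pi * α / ω := by ring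
  simp only [e1, e2, Real.cos_pi, Real.sin_pi] at this
  linarith

/-- A function that is negative just before `s` and vanishes at `s` has nonnegative derivative
there. -/
theorem _root_.HasDerivAt.nonneg_of_neg_left {f : ℝ → ℝ} {f' r s : ℝ} (h : HasDerivAt f f' s)
    (hrs : r < s) (hf : ∀ t ∈ Ioo r s, f t < 0) (hs : f s = 0) : 0 ≤ f' := by
  have h1 := (hasDerivAt_iff_tendsto_slope_left_right.1 h).1
  refine ge_of_tendsto h1 ?_
  filter_upwards [Ioo_mem_nhdsLT hrs] with t ht
  rw [slope_def_field, hs]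
  exact div_nonneg_of_nonpos (by linarith [hf t ht]) (by linarith [ht.2])

/-- A function that is negative just after `s` and vanishes at `s` has nonpositive derivative
there. -/
theorem _root_.HasDerivAt.nonpos_of_neg_right {f : ℝ → ℝ} {f' r s : ℝ} (h : HasDerivAt f f' s)
    (hrs : s < r) (hf : ∀ t ∈ Ioo s r, f t < 0) (hs : f s = 0) : f' ≤ 0 := by
  have h1 := (hasDerivAt_iff_tendsto_slope_left_right.1 h).2
  refine le_of_tendsto h1 ?_
  filter_upwards [Ioo_mem_nhdsGT hrs] with t ht
  rw [slope_def_field, hs]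
  exact div_nonpos_of_nonpos_of_nonneg (by linarith [hf t ht]) (by linarith [ht.1])

/-- An excursion to the negative side of an oscillator with equilibrium `κ / (α ^ 2 + ω ^ 2) < 0`
goes round the equilibrium, and negative damping lets it return with at least the stated speed,
however it started. -/
theorem landing_of_neg (h : Oscillator α ω κ x v) (hω : 0 < ω) (hα : 0 < α) (hκ : κ < 0)
    (hx0 : x 0 = 0) {s : ℝ} (hs : 0 < s) (hneg : ∀ t ∈ Ioo 0 s, x t < 0) (hxs : x s = 0) :
    0 ≤ v s ∧ 8 * α * (κ / (α ^ 2 + ω ^ 2)) ^ 2 * ω / Real.pi ≤ v s ^ 2 := by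
  have hΔ : 0 < α ^ 2 + ω ^ 2 := sq_add_sq_pos hω
  have hpi := Real.pi_pos
  set c := κ / (α ^ 2 + ω ^ 2) with hc
  have hc0 : c < 0 := div_neg_of_neg_of_pos hκ hΔ
  have hcΔ : κ = (α ^ 2 + ω ^ 2) * c := by rw [hc]; field_simp
  refine ⟨(h.dx s).nonneg_of_neg_left hs hneg hxs, ?_⟩
  -- the excursion lasts at most one turn
  have hsle : s ≤ 2 * Real.pi / ω := by
    by_contra hlt
    push Not at hlt
    have h1 := hneg (2 * Real.pi / ω) ⟨by positivity, hlt⟩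
    have h2 := h.displacement_full_turn hω
    rw [← hc, hx0] at h2
    have h3 : 1 < Real.exp (2 * Real.pi * α / ω) := Real.one_lt_exp_iff.2 (by positivity)
    nlinarith
  obtain ⟨m, hm, hmin⟩ := isCompact_Icc.exists_isMinOn (nonempty_Icc.2 hs.le)
    h.continuous_x.continuousOn (s := Icc 0 s)
  have hxm : x m < 0 :=
    (hmin (a := s / 2) ⟨by linarith, by linarith⟩).trans_lt
      (hneg _ ⟨by linarith, by linarith⟩)
  have hm0 : 0 < m := lt_of_le_of_ne hm.1 (by rintro rfl; linarith)
  have hms : m < s := lt_of_le_of_ne hm.2 (by rintro rfl; linarith)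
  have hvm : v m = 0 := by
    have : IsLocalMin x m := (hmin.isLocalMin (Icc_mem_nhds hm0 hms))
    exact this.hasDerivAt_eq_zero (h.dx m)
  have hmono : MonotoneOn (fun t => v t ^ 2 / 2 + (α ^ 2 + ω ^ 2) * x t ^ 2 / 2 - κ * x t)
      univ := by
    refine (monotone_of_deriv_nonneg (fun t => (h.hasDerivAt_energy t).differentiableAt)
      fun t => ?_).monotoneOn _
    rw [(h.hasDerivAt_energy t).deriv]
    positivity
  have hE0 := hmono (mem_univ 0) (mem_univ m) hm0.le
  have hEs := hmono (mem_univ m) (mem_univ s) hms.le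
  simp only [hx0, hvm, hxs] at hE0 hEs
  -- the turning point lies beyond the equilibrium
  have hxm2 : x m ≤ 2 * c := by
    by_contra hlt
    push Not at hlt
    rw [hcΔ] at hE0
    have : (α ^ 2 + ω ^ 2) * (x m * (x m - 2 * c)) < 0 :=
      mul_neg_of_pos_of_neg hΔ (mul_neg_of_neg_of_pos hxm (by linarith))
    nlinarith [sq_nonneg (v 0)]
  -- Cauchy-Schwarz for the integral of `v ^ 2` over `[0, m]`, by completing the square
  set l := -x m / m with hl
  have hlm : l * m = -x m := by rw [hl]; field_simp
  have hmono2 : Monotone (fun t => v t ^ 2 / 2 + (α ^ 2 + ω ^ 2) * x t ^ 2 / 2 - κ * x t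
      + 2 * α * (2 * l * x t + l ^ 2 * t)) := by
    have hd : ∀ t, HasDerivAt (fun t => v t ^ 2 / 2 + (α ^ 2 + ω ^ 2) * x t ^ 2 / 2 - κ * x t
      + 2 * α * (2 * l * x t + l ^ 2 * t)) (2 * α * (v t + l) ^ 2) t := by
      intro t
      refine HasDerivAt.congr_deriv (((h.hasDerivAt_energy t).add ((((h.dx t).const_mul (2 * l)).add
        ((hasDerivAt_id t).const_mul (l ^ 2))).const_mul (2 * α)))) ?_
      ring
    refine monotone_of_deriv_nonneg (fun t => (hd t).differentiableAt) fun t => ?_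
    rw [(hd t).deriv]
    positivity
  have hE1 := hmono2 hm0.le
  simp only [hx0, hvm] at hE1
  have hgain : 2 * α * (x m ^ 2 / m) ≤ v s ^ 2 / 2 := by
    have : x m ^ 2 / m = -(2 * l * x m + l ^ 2 * m) := by
      rw [hl]; field_simp; ring
    rw [this]
    nlinarith [sq_nonneg (v 0)]
  have hstep : 4 * c ^ 2 * ω / (2 * Real.pi) ≤ x m ^ 2 / m := by
    rw [div_le_div_iff₀ (by positivity) hm0]
    have h1 : 4 * c ^ 2 ≤ x m ^ 2 := by nlinarith
    have h2 : m * ω ≤ 2 * Real.pi := by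
      have := hms.le.trans hsle
      rwa [le_div_iff₀ hω] at this
    calc 4 * c ^ 2 * ω * m = (4 * c ^ 2) * (m * ω) := by ring
      _ ≤ x m ^ 2 * (2 * Real.pi) := by gcongr
  have : 8 * α * c ^ 2 * ω / Real.pi = 4 * α * (4 * c ^ 2 * ω / (2 * Real.pi)) := by
    field_simp; ring
  rw [this]
  have := mul_le_mul_of_nonneg_left hstep (by positivity : 0 ≤ 4 * α)
  linarith

/-- An excursion to the positive side of an oscillator whose equilibrium is negative returns
with almost the speed with which it started, if the damping is small. -/
theorem landing_of_pos (h : Oscillator α ω κ x v) (hω : 0 < ω) (hκ : κ < 0)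
    (hx0 : x 0 = 0) (hv0 : 0 < v 0) {s : ℝ} (hs : 0 < s) (hpos : ∀ t ∈ Ioo 0 s, 0 < x t)
    (hxs : x s = 0) :
    v 0 * Real.exp (-(2 * |α| * (Real.pi / ω))) ≤ -v s ∧
      -v s ≤ v 0 * Real.exp (2 * |α| * (Real.pi / ω)) := by
  have hΔ : 0 < α ^ 2 + ω ^ 2 := sq_add_sq_pos hω
  have hpi := Real.pi_pos
  have hc0 : κ / (α ^ 2 + ω ^ 2) < 0 := div_neg_of_neg_of_pos hκ hΔ
  have hvs : 0 ≤ -v s := by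
    refine (h.dx s).neg.nonneg_of_neg_left hs (fun t ht => ?_) (by simp [hxs])
    simpa using hpos t ht
  have hsle : s ≤ Real.pi / ω := by
    by_contra hlt
    push Not at hlt
    have h1 := hpos (Real.pi / ω) ⟨by positivity, hlt⟩
    have h2 := h.displacement_half_turn hω
    rw [hx0] at h2
    have h3 := Real.exp_pos (Real.pi * α / ω)
    nlinarith
  set E : ℝ → ℝ := fun t => v t ^ 2 / 2 + (α ^ 2 + ω ^ 2) * x t ^ 2 / 2 - κ * x t with hE
  have hx : ∀ t ∈ Ioo 0 s, v t ^ 2 / 2 ≤ E t := by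
    intro t ht
    have h1 := hpos t ht
    have : 0 ≤ (α ^ 2 + ω ^ 2) * x t ^ 2 / 2 := by positivity
    simp only [hE]
    nlinarith
  have hd : ∀ k t, HasDerivAt (fun t => Real.exp (k * t) * E t)
      (Real.exp (k * t) * (k * E t + 2 * α * v t ^ 2)) t := by
    intro k t
    refine ((hasDerivAt_exp_mul k t).mul (h.hasDerivAt_energy t)).congr_deriv ?_
    simp only [hE]; ring
  have hcont : ∀ k, ContinuousOn (fun t => Real.exp (k * t) * E t) (Icc 0 s) := fun k =>
    (continuous_iff_continuousAt.2 fun t => (hd k t).continuousAt).continuousOn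
  have hup : MonotoneOn (fun t => Real.exp ((4 * |α|) * t) * E t) (Icc 0 s) := by
    refine monotoneOn_of_deriv_nonneg (convex_Icc _ _) (hcont _)
      (fun t _ => (hd _ t).differentiableAt.differentiableWithinAt) fun t ht => ?_
    rw [(hd _ t).deriv]
    rw [interior_Icc] at ht
    have h1 := hx t ht
    have h2 := neg_abs_le α
    have h3 : 0 ≤ |α| := abs_nonneg α
    refine mul_nonneg (Real.exp_pos _).le ?_
    nlinarith [sq_nonneg (v t), mul_le_mul_of_nonneg_left h1 h3]
  have hdown : AntitoneOn (fun t => Real.exp ((-(4 * |α|)) * t) * E t) (Icc 0 s) := by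
    refine antitoneOn_of_deriv_nonpos (convex_Icc _ _) (hcont _)
      (fun t _ => (hd _ t).differentiableAt.differentiableWithinAt) fun t ht => ?_
    rw [(hd _ t).deriv]
    rw [interior_Icc] at ht
    have h1 := hx t ht
    have h2 := le_abs_self α
    have h3 : 0 ≤ |α| := abs_nonneg α
    refine mul_nonpos_of_nonneg_of_nonpos (Real.exp_pos _).le ?_
    nlinarith [sq_nonneg (v t), mul_le_mul_of_nonneg_left h1 h3]
  have hl : (0 : ℝ) ∈ Icc 0 s := ⟨le_rfl, hs.le⟩
  have hr : s ∈ Icc 0 s := ⟨hs.le, le_rfl⟩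
  have h1 := hup hl hr hs.le
  have h2 := hdown hl hr hs.le
  simp only [hE, hx0, hxs, mul_zero, Real.exp_zero, one_mul] at h1 h2
  set q := Real.exp (2 * |α| * (Real.pi / ω)) with hq
  have hq0 : 0 < q := Real.exp_pos _
  have hqq : Real.exp (4 * |α| * s) ≤ q ^ 2 := by
    rw [hq, ← Real.exp_nat_mul, Real.exp_le_exp]
    push_cast
    have := mul_le_mul_of_nonneg_left hsle (abs_nonneg α)
    nlinarith
  have hexp : Real.exp (-(4 * |α|) * s) * Real.exp (4 * |α| * s) = 1 := by
    rw [← Real.exp_add]; simp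
  have hep := Real.exp_pos (4 * |α| * s)
  constructor
  · rw [Real.exp_neg, ← hq, mul_inv_le_iff₀ hq0]
    refine (abs_le_of_sq_le_sq' ?_ (by positivity)).2
    have : Real.exp (4 * |α| * s) * v s ^ 2 ≤ q ^ 2 * v s ^ 2 := by gcongr
    nlinarith
  · refine abs_le_of_sq_le_sq' ?_ (by positivity) |>.2
    have h3 : v s ^ 2 ≤ Real.exp (4 * |α| * s) * v 0 ^ 2 := by
      have := mul_le_mul_of_nonneg_left h2 hep.le
      have e : Real.exp (4 * |α| * s) * (Real.exp (-(4 * |α|) * s) * (v s ^ 2 / 2 +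
        (α ^ 2 + ω ^ 2) * 0 ^ 2 / 2 - 0)) = v s ^ 2 / 2 := by
        linear_combination (v s ^ 2 / 2) * hexp
      nlinarith
    have : Real.exp (4 * |α| * s) * v 0 ^ 2 ≤ q ^ 2 * v 0 ^ 2 := by gcongr
    nlinarith

end Oscillator

/-! ### Excursions of an oscillator -/

namespace Oscillator

variable {α ω κ : ℝ} {x v : ℝ → ℝ}

/-- The position turns round once on `[0, s]`, so the phase point visits no state twice. -/
theorem injOn_of_turn (h : Oscillator α ω κ x v) {m s : ℝ}
    (h1 : ∀ t ∈ Ioo 0 m, 0 < v t) (h2 : ∀ t ∈ Ioo m s, v t < 0) (hm : v m = 0)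
    (hv0 : 0 ≤ v 0) :
    InjOn (fun t => (x t, v t)) (Ico 0 s) := by
  have hinc : StrictMonoOn x (Icc 0 m) := by
    refine strictMonoOn_of_deriv_pos (convex_Icc _ _) h.continuous_x.continuousOn fun t ht => ?_
    rw [interior_Icc] at ht
    rw [(h.dx t).deriv]
    exact h1 t ht
  have hdec : StrictAntiOn x (Icc m s) := by
    refine strictAntiOn_of_deriv_neg (convex_Icc _ _) h.continuous_x.continuousOn fun t ht => ?_
    rw [interior_Icc] at ht
    rw [(h.dx t).deriv]
    exact h2 t ht
  have hnn : ∀ t ∈ Ico 0 s, t ≤ m → 0 ≤ v t := by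
    intro t ht htm
    rcases htm.eq_or_lt with rfl | htm
    · exact hm.ge
    rcases ht.1.eq_or_lt with rfl | ht0
    · exact hv0
    · exact (h1 t ⟨ht0, htm⟩).le
  intro t ht t' ht' heq
  simp only [Prod.mk.injEq] at heq
  rcases le_or_gt t m with a | a <;> rcases le_or_gt t' m with b | b
  · exact hinc.injOn ⟨ht.1, a⟩ ⟨ht'.1, b⟩ heq.1
  · have := h2 t' ⟨b, ht'.2⟩
    have := hnn t ht a
    linarith [heq.2]
  · have := h2 t ⟨a, ht.2⟩
    have := hnn t' ht' b
    linarith [heq.2]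
  · exact hdec.injOn ⟨a.le, ht.2.le⟩ ⟨b.le, ht'.2.le⟩ heq.1

theorem neg (h : Oscillator α ω κ x v) :
    Oscillator α ω (-κ) (fun t => -x t) (fun t => -v t) where
  dx t := (h.dx t).neg
  dv t := (h.dv t).neg.congr_deriv (by ring)

/-- An oscillator with negative equilibrium that starts with positive velocity at `0` makes an
excursion to the positive side and returns. -/
theorem exists_return_of_pos (h : Oscillator α ω κ x v) (hω : 0 < ω) (hκ : κ < 0)
    (hx0 : x 0 = 0) (hv0 : 0 < v 0) :
    ∃ s, 0 < s ∧ (∀ t ∈ Ioo 0 s, 0 < x t) ∧ x s = 0 ∧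
      InjOn (fun t => (x t, v t)) (Ico 0 s) := by
  have hΔ : 0 < α ^ 2 + ω ^ 2 := sq_add_sq_pos hω
  have hpi := Real.pi_pos
  -- amplitude and phase of the velocity
  set σ := -((2 * α * v 0 - (α ^ 2 + ω ^ 2) * x 0 + κ - α * v 0) / ω) with hσ
  set φ := Real.arctan (σ / v 0) with hφ
  have hφ1 : -(Real.pi / 2) < φ := Real.neg_pi_div_two_lt_arctan _
  have hφ2 : φ < Real.pi / 2 := Real.arctan_lt_pi_div_two _
  have hcos : 0 < Real.cos φ := Real.cos_arctan_pos _
  have htan : σ * Real.cos φ = v 0 * Real.sin φ := by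
    have := Real.tan_arctan (σ / v 0)
    rw [← hφ, Real.tan_eq_sin_div_cos] at this
    field_simp at this
    linarith
  set θ := Real.pi / 2 - φ with hθ
  have hv : ∀ t, v t = v 0 / Real.cos φ * (Real.exp (α * t) * Real.sin (θ - ω * t)) := by
    intro t
    have e : Real.sin (Real.pi / 2 - φ - ω * t) = Real.cos (φ + ω * t) := by
      rw [← Real.sin_pi_div_two_sub]; congr 1; ring
    have hσ' : (2 * α * v 0 - (α ^ 2 + ω ^ 2) * x 0 + κ - α * v 0) / ω = -σ := by
      rw [hσ, neg_neg]
    have hf := h.velocity.homogeneous_eq hω t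
    simp only [hσ'] at hf
    rw [hf, hθ, e, Real.cos_add]
    field_simp
    linear_combination (-Real.sin (t * ω)) * htan
  have hR : 0 < v 0 / Real.cos φ := div_pos hv0 hcos
  set m := θ / ω with hm
  have hθ0 : 0 < θ := by linarith
  have hm0 : 0 < m := div_pos hθ0 hω
  set r := m + Real.pi / ω with hr
  have hmr : m < r := lt_add_of_pos_right m (by positivity)
  have hωm : ω * m = θ := by rw [hm]; field_simp
  have hωr : ω * r = θ + Real.pi := by rw [hr, mul_add, hωm]; field_simp
  have h1 : ∀ t ∈ Ico 0 m, 0 < v t := by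
    intro t ht
    rw [hv t]
    have : 0 < Real.sin (θ - ω * t) := by
      apply Real.sin_pos_of_pos_of_lt_pi
      · nlinarith [ht.2]
      · nlinarith [ht.1]
    positivity
  have h2 : ∀ t ∈ Ioo m r, v t < 0 := by
    intro t ht
    rw [hv t]
    have : Real.sin (θ - ω * t) < 0 := by
      apply Real.sin_neg_of_neg_of_neg_pi_lt
      · nlinarith [ht.1]
      · nlinarith [ht.2]
    have := mul_neg_of_pos_of_neg (Real.exp_pos (α * t)) this
    exact mul_neg_of_pos_of_neg hR this
  have hvm : v m = 0 := by rw [hv, hωm]; simp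
  have hinc : StrictMonoOn x (Icc 0 m) := by
    refine strictMonoOn_of_deriv_pos (convex_Icc _ _) h.continuous_x.continuousOn fun t ht => ?_
    rw [interior_Icc] at ht
    rw [(h.dx t).deriv]
    exact h1 t ⟨ht.1.le, ht.2⟩
  have hdec : StrictAntiOn x (Icc m r) := by
    refine strictAntiOn_of_deriv_neg (convex_Icc _ _) h.continuous_x.continuousOn fun t ht => ?_
    rw [interior_Icc] at ht
    rw [(h.dx t).deriv]
    exact h2 t ht
  have hxm : 0 < x m := by
    have := hinc ⟨le_rfl, hm0.le⟩ ⟨hm0.le, le_rfl⟩ hm0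
    rwa [hx0] at this
  -- at the lower turning point the acceleration is nonnegative
  have hxr : x r < 0 := by
    have hvr : v r = 0 := by rw [hv, hωr]; simp
    have hd := (h.dv r).nonneg_of_neg_left hmr h2 hvr
    rw [hvr] at hd
    nlinarith
  obtain ⟨s, hs, hxs⟩ : (0 : ℝ) ∈ x '' Icc m r :=
    intermediate_value_Icc' hmr.le h.continuous_x.continuousOn ⟨hxr.le, hxm.le⟩
  have hms : m < s := lt_of_le_of_ne hs.1 (by rintro rfl; linarith)
  refine ⟨s, hm0.trans hms, fun t ht => ?_, hxs, ?_⟩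
  · rcases le_or_gt t m with a | a
    · have := hinc ⟨le_rfl, hm0.le⟩ ⟨ht.1.le, a⟩ ht.1
      rwa [hx0] at this
    · have := hdec ⟨a.le, ht.2.le.trans hs.2⟩ hs ht.2
      rwa [hxs] at this
  · exact h.injOn_of_turn (fun t ht => h1 t ⟨ht.1.le, ht.2⟩)
      (fun t ht => h2 t ⟨ht.1, ht.2.trans_le hs.2⟩) hvm hv0.le

/-- The orbit that starts at rest at `0`. If `s` solves the transcendental equation `hroot`, then
`2 π - s` is the angle through which it turns round the equilibrium before it returns to `0`. -/
theorem return_of_rest (h : Oscillator α ω κ x v) (hω : 0 < ω) (hκ : κ < 0)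
    (hx0 : x 0 = 0) (hv0 : v 0 = 0) {s : ℝ} (hs : s ∈ Ioo 0 Real.pi)
    (hroot : Real.exp (α / ω * (2 * Real.pi - s)) * (Real.cos s + α / ω * Real.sin s) = 1) :
    (∀ t ∈ Ioo 0 ((2 * Real.pi - s) / ω), x t < 0) ∧ x ((2 * Real.pi - s) / ω) = 0 ∧
      v ((2 * Real.pi - s) / ω)
        = -κ / ω * (Real.exp (α / ω * (2 * Real.pi - s)) * Real.sin s) ∧
      InjOn (fun t => (x t, v t)) (Ico 0 ((2 * Real.pi - s) / ω)) := by
  have hΔ : 0 < α ^ 2 + ω ^ 2 := sq_add_sq_pos hω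
  have hpi := Real.pi_pos
  set r := (2 * Real.pi - s) / ω with hr
  have hωr : ω * r = 2 * Real.pi - s := by rw [hr]; field_simp
  have hαr : α * r = α / ω * (2 * Real.pi - s) := by rw [hr]; ring
  have hv : ∀ t, v t = κ / ω * (Real.exp (α * t) * Real.sin (ω * t)) := by
    intro t
    rw [h.velocity.homogeneous_eq hω t, hv0, hx0]
    ring
  have hκω : κ / ω < 0 := div_neg_of_neg_of_pos hκ hω
  set m := Real.pi / ω with hm
  have hm0 : 0 < m := div_pos hpi hω
  have hωm : ω * m = Real.pi := by rw [hm]; field_simp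
  have hmr : m < r := by
    have : ω * m < ω * r := by rw [hωm, hωr]; linarith [hs.2]
    exact lt_of_mul_lt_mul_left this hω.le
  have h1 : ∀ t ∈ Ioo 0 m, v t < 0 := by
    intro t ht
    rw [hv t]
    have : 0 < Real.sin (ω * t) := by
      apply Real.sin_pos_of_pos_of_lt_pi
      · exact mul_pos hω ht.1
      · nlinarith [ht.2]
    exact mul_neg_of_neg_of_pos hκω (by positivity)
  have h2 : ∀ t ∈ Ioo m r, 0 < v t := by
    intro t ht
    rw [hv t]
    have : Real.sin (ω * t) < 0 := by
      rw [← Real.sin_sub_two_pi]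
      apply Real.sin_neg_of_neg_of_neg_pi_lt
      · nlinarith [ht.2, hs.1]
      · nlinarith [ht.1]
    have := mul_neg_of_pos_of_neg (Real.exp_pos (α * t)) this
    exact mul_pos_of_neg_of_neg hκω this
  have hvm : v m = 0 := by rw [hv, hωm]; simp
  have hdec : StrictAntiOn x (Icc 0 m) := by
    refine strictAntiOn_of_deriv_neg (convex_Icc _ _) h.continuous_x.continuousOn fun t ht => ?_
    rw [interior_Icc] at ht
    rw [(h.dx t).deriv]
    exact h1 t ht
  have hinc : StrictMonoOn x (Icc m r) := by
    refine strictMonoOn_of_deriv_pos (convex_Icc _ _) h.continuous_x.continuousOn fun t ht => ?_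
    rw [interior_Icc] at ht
    rw [(h.dx t).deriv]
    exact h2 t ht
  have hsin : Real.sin (2 * Real.pi - s) = -Real.sin s := Real.sin_two_pi_sub s
  have hcos : Real.cos (2 * Real.pi - s) = Real.cos s := Real.cos_two_pi_sub s
  have hxr : x r = 0 := by
    have := (h.displacement hω).homogeneous_eq hω r
    simp only [hx0, hv0, hωr, hαr, hsin, hcos] at this
    have e : Real.exp (α / ω * (2 * Real.pi - s)) * ((0 - κ / (α ^ 2 + ω ^ 2)) * Real.cos s +
        (0 - α * (0 - κ / (α ^ 2 + ω ^ 2))) / ω * -Real.sin s) = -(κ / (α ^ 2 + ω ^ 2)) := by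
      linear_combination (-(κ / (α ^ 2 + ω ^ 2))) * hroot
    rw [e] at this
    linarith
  refine ⟨fun t ht => ?_, hxr, ?_, ?_⟩
  · rcases le_or_gt t m with a | a
    · have := hdec ⟨le_rfl, hm0.le⟩ ⟨ht.1.le, a⟩ ht.1
      rwa [hx0] at this
    · have := hinc ⟨a.le, ht.2.le⟩ ⟨hmr.le, le_rfl⟩ ht.2
      rwa [hxr] at this
  · rw [hv, hωr, hαr, hsin]; ring
  · intro t ht t' ht' heq
    have := h.neg.injOn_of_turn (m := m) (s := r) (fun t ht => by linarith [h1 t ht])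
      (fun t ht => by linarith [h2 t ht]) (by linarith) (by linarith)
    refine this ht ht' ?_
    simpa using heq

end Oscillator

/-! ### The return angle of a weakly unstable focus -/

theorem exists_return_angle {k : ℝ} (hk : 0 < k) :
    ∃ s ∈ Ioo 0 Real.pi,
      Real.exp (k * (2 * Real.pi - s)) * (Real.cos s + k * Real.sin s) = 1 := by
  have hpi := Real.pi_pos
  have hc : Continuous fun s : ℝ =>
      Real.exp (k * (2 * Real.pi - s)) * (Real.cos s + k * Real.sin s) := by fun_prop
  have := intermediate_value_Ioo' hpi.le hc.continuousOn
  refine this ⟨?_, ?_⟩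
  · simp only [Real.cos_pi, Real.sin_pi]
    linarith [Real.exp_pos (k * (2 * Real.pi - Real.pi))]
  · simp only [Real.cos_zero, Real.sin_zero, mul_zero, add_zero, mul_one, sub_zero]
    exact Real.one_lt_exp_iff.2 (by positivity)

/-- Asymptotics of the return angle `2 π - s` of a weakly unstable focus. -/
theorem exists_return_angle_asymptotics :
    ∃ s : ℝ → ℝ, (∀ k, 0 < k → s k ∈ Ioo 0 Real.pi ∧
      Real.exp (k * (2 * Real.pi - s k)) * (Real.cos (s k) + k * Real.sin (s k)) = 1) ∧
      Tendsto (fun k => (Real.exp (k * (2 * Real.pi - s k)) * Real.sin (s k)) ^ 2 / k)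
        (𝓝[>] 0) (𝓝 (4 * Real.pi)) := by
  have hpi := Real.pi_pos
  choose! s hs hroot using fun k (hk : 0 < k) => exists_return_angle hk
  refine ⟨s, fun k hk => ⟨hs k hk, hroot k hk⟩, ?_⟩
  have hpos : ∀ᶠ k : ℝ in 𝓝[>] 0, 0 < k := self_mem_nhdsWithin
  have hid : Tendsto (fun k : ℝ => k) (𝓝[>] 0) (𝓝 0) := tendsto_nhdsWithin_of_tendsto_nhds
    tendsto_id
  -- the exponent tends to zero
  have hz : Tendsto (fun k => k * (2 * Real.pi - s k)) (𝓝[>] 0) (𝓝 0) := by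
    refine tendsto_of_tendsto_of_tendsto_of_le_of_le' tendsto_const_nhds
      (by simpa using hid.mul_const (2 * Real.pi)) ?_ ?_
    · filter_upwards [hpos] with k hk
      have := (hs k hk).2
      exact mul_nonneg hk.le (by linarith)
    · filter_upwards [hpos] with k hk
      have := (hs k hk).1
      exact mul_le_mul_of_nonneg_left (by linarith) hk.le
  have hksin : Tendsto (fun k => k * Real.sin (s k)) (𝓝[>] 0) (𝓝 0) := by
    refine squeeze_zero_norm' ?_ hid
    filter_upwards [hpos] with k hk
    rw [norm_mul, Real.norm_eq_abs, Real.norm_eq_abs, abs_of_pos hk]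
    exact mul_le_of_le_one_right hk.le (Real.abs_sin_le_one _)
  have hexpz : Tendsto (fun k => Real.exp (-(k * (2 * Real.pi - s k)))) (𝓝[>] 0) (𝓝 1) := by
    simpa using hz.neg.rexp
  have hcoseq : ∀ᶠ k : ℝ in 𝓝[>] 0,
      Real.cos (s k) = Real.exp (-(k * (2 * Real.pi - s k))) - k * Real.sin (s k) := by
    filter_upwards [hpos] with k hk
    have h1 := hroot k hk
    have h2 : Real.exp (-(k * (2 * Real.pi - s k))) * Real.exp (k * (2 * Real.pi - s k)) = 1 := by
      rw [← Real.exp_add]; simp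
    linear_combination (-(Real.cos (s k) + k * Real.sin (s k))) * h2 +
      Real.exp (-(k * (2 * Real.pi - s k))) * h1
  have hcos : Tendsto (fun k => Real.cos (s k)) (𝓝[>] 0) (𝓝 1) := by
    have := hexpz.sub hksin
    rw [sub_zero] at this
    exact this.congr' (hcoseq.mono fun k hk => hk.symm)
  have hs0 : Tendsto s (𝓝[>] 0) (𝓝 0) := by
    have h1 : Tendsto (fun k => Real.arccos (Real.cos (s k))) (𝓝[>] 0) (𝓝 0) := by
      have := (Real.continuous_arccos.tendsto 1).comp hcos
      rwa [Real.arccos_one] at this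
    refine h1.congr' ?_
    filter_upwards [hpos] with k hk
    exact Real.arccos_cos (hs k hk).1.le (hs k hk).2.le
  have hsin : Tendsto (fun k => Real.sin (s k)) (𝓝[>] 0) (𝓝 0) := by
    have := (Real.continuous_sin.tendsto 0).comp hs0
    rwa [Real.sin_zero] at this
  -- `(1 - exp (-z)) / z → 1`
  have hslope : Tendsto (fun k => (1 - Real.exp (-(k * (2 * Real.pi - s k)))) /
      (k * (2 * Real.pi - s k))) (𝓝[>] 0) (𝓝 1) := by
    have h1 : Tendsto (fun z : ℝ => slope (fun z => -Real.exp (-z)) 0 z) (𝓝[≠] 0) (𝓝 1) := by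
      have : HasDerivAt (fun z : ℝ => -Real.exp (-z)) 1 0 := by
        exact ((hasDerivAt_id (0 : ℝ)).neg.exp).neg.congr_deriv (by simp)
      exact hasDerivAt_iff_tendsto_slope.1 this
    have h2 : Tendsto (fun k => k * (2 * Real.pi - s k)) (𝓝[>] 0) (𝓝[≠] 0) := by
      refine tendsto_nhdsWithin_iff.2 ⟨hz, ?_⟩
      filter_upwards [hpos] with k hk
      have := (hs k hk).2
      exact (mul_pos hk (by linarith)).ne'
    refine (h1.comp h2).congr fun k => ?_
    simp [slope_def_field]
    ring
  have hmain : Tendsto (fun k => Real.exp (k * (2 * Real.pi - s k)) ^ 2 *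
      ((Real.sin (s k) + (1 - Real.exp (-(k * (2 * Real.pi - s k)))) /
      (k * (2 * Real.pi - s k)) * (2 * Real.pi - s k)) * (1 + Real.cos (s k))))
      (𝓝[>] 0) (𝓝 (4 * Real.pi)) := by
    have h1 : Tendsto (fun k => 2 * Real.pi - s k) (𝓝[>] 0) (𝓝 (2 * Real.pi - 0)) :=
      hs0.const_sub _
    have h2 := ((hz.rexp).pow 2).mul ((hsin.add (hslope.mul h1)).mul (hcos.const_add 1))
    convert h2 using 2
    simp
    ring
  refine hmain.congr' ?_
  filter_upwards [hpos, hcoseq] with k hk hck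
  have h1 : 2 * Real.pi - s k ≠ 0 := by have := (hs k hk).2; linarith
  have h2 : (1 - Real.exp (-(k * (2 * Real.pi - s k)))) / (k * (2 * Real.pi - s k)) *
      (2 * Real.pi - s k) = (1 - Real.exp (-(k * (2 * Real.pi - s k)))) / k := by
    field_simp
  rw [h2]
  have h3 : Real.sin (s k) + (1 - Real.exp (-(k * (2 * Real.pi - s k)))) / k
      = (1 - Real.cos (s k)) / k := by
    rw [hck]; field_simp; ring
  rw [h3, mul_pow, Real.sin_sq]
  field_simp
  ring

/-! ### Planar affine fields -/

section AffineFlow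

/-- A solution, defined for all times, of the affine planar system `p' = M p + u`. -/
def AffineFlow (M : Matrix (Fin 2) (Fin 2) ℝ) (u : Fin 2 → ℝ) (X : ℝ → Fin 2 → ℝ) : Prop :=
  ∀ t, HasDerivAt X (M *ᵥ X t + u) t

/-- Half the trace: the growth rate of the focus. -/
noncomputable def focusRate (M : Matrix (Fin 2) (Fin 2) ℝ) : ℝ := (M 0 0 + M 1 1) / 2

/-- The angular frequency of the focus; meaningful if `0 < det M - (tr M / 2) ^ 2`. -/
noncomputable def focusFreq (M : Matrix (Fin 2) (Fin 2) ℝ) : ℝ :=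
  √(M 0 0 * M 1 1 - M 0 1 * M 1 0 - focusRate M ^ 2)

/-- The acceleration `x''` of the affine field at a point where `x = x' = 0`. -/
def foldAccel (M : Matrix (Fin 2) (Fin 2) ℝ) (u : Fin 2 → ℝ) : ℝ :=
  M 0 1 * u 1 - M 1 1 * u 0

/-- The ordinate of the fold: the point of the switching line at which the affine field is
tangent to it. -/
noncomputable def foldPoint (M : Matrix (Fin 2) (Fin 2) ℝ) (u : Fin 2 → ℝ) : ℝ :=
  -u 0 / M 0 1

/-- The affine field has a focus or a center in `x < 0`, and it crosses the switching line to the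
left above its fold. -/
structure IsFocus (M : Matrix (Fin 2) (Fin 2) ℝ) (u : Fin 2 → ℝ) : Prop where
  disc : 0 < M 0 0 * M 1 1 - M 0 1 * M 1 0 - focusRate M ^ 2
  coupling : M 0 1 < 0
  accel : foldAccel M u < 0

theorem IsFocus.freq_pos {M : Matrix (Fin 2) (Fin 2) ℝ} {u : Fin 2 → ℝ} (h : IsFocus M u) :
    0 < focusFreq M := Real.sqrt_pos.2 h.disc

theorem IsFocus.det_eq {M : Matrix (Fin 2) (Fin 2) ℝ} {u : Fin 2 → ℝ} (h : IsFocus M u) :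
    focusRate M ^ 2 + focusFreq M ^ 2 = M 0 0 * M 1 1 - M 0 1 * M 1 0 := by
  rw [focusFreq, Real.sq_sqrt h.disc.le]; ring

theorem affine_apply_zero (M : Matrix (Fin 2) (Fin 2) ℝ) (u p : Fin 2 → ℝ) :
    (M *ᵥ p + u) 0 = M 0 0 * p 0 + M 0 1 * p 1 + u 0 := by
  simp

theorem affine_apply_one (M : Matrix (Fin 2) (Fin 2) ℝ) (u p : Fin 2 → ℝ) :
    (M *ᵥ p + u) 1 = M 1 0 * p 0 + M 1 1 * p 1 + u 1 := by
  simp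

variable {M : Matrix (Fin 2) (Fin 2) ℝ} {u : Fin 2 → ℝ} {X : ℝ → Fin 2 → ℝ}

/-- On the switching line the normal velocity is proportional to the distance from the fold. -/
theorem IsFocus.normal_velocity (h : IsFocus M u) {p : Fin 2 → ℝ} (hp : p 0 = 0) :
    (M *ᵥ p + u) 0 = M 0 1 * (p 1 - foldPoint M u) := by
  have := h.coupling.ne
  rw [affine_apply_zero, hp, foldPoint]
  field_simp
  ring

/-- The abscissa of an orbit is an oscillator. -/
theorem AffineFlow.oscillator (hX : AffineFlow M u X) (h : IsFocus M u) :
    Oscillator (focusRate M) (focusFreq M) (foldAccel M u) (fun t => X t 0)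
      (fun t => (M *ᵥ X t + u) 0) where
  dx t := hasDerivAt_pi.1 (hX t) 0
  dv t := by
    have h0 := hasDerivAt_pi.1 (hX t) 0
    have h1 := hasDerivAt_pi.1 (hX t) 1
    simp only [affine_apply_zero, affine_apply_one] at h0 h1 ⊢
    refine HasDerivAt.congr_deriv
      (((h0.const_mul (M 0 0)).add (h1.const_mul (M 0 1))).add_const (u 0)) ?_
    rw [h.det_eq, focusRate, foldAccel]
    ring

theorem IsFocus.exists_flow (h : IsFocus M u) (p : Fin 2 → ℝ) :
    ∃ X, AffineFlow M u X ∧ X 0 = p := by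
  obtain ⟨x, v, ho, hx, hv⟩ := Oscillator.exists_solution (focusRate M) (foldAccel M u)
    h.freq_pos (p 0) ((M *ᵥ p + u) 0)
  have hne := h.coupling.ne
  refine ⟨fun t => ![x t, (v t - M 0 0 * x t - u 0) / M 0 1], fun t => ?_, ?_⟩
  · rw [hasDerivAt_pi]
    intro i
    fin_cases i
    · simp only [Fin.zero_eta, affine_apply_zero]
      refine (ho.dx t).congr_deriv ?_
      simp
      field_simp
      ring
    · simp only [Fin.mk_one, affine_apply_one]
      refine HasDerivAt.congr_deriv
        ((((ho.dv t).sub ((ho.dx t).const_mul (M 0 0))).sub_const (u 0)).div_const (M 0 1)) ?_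
      rw [h.det_eq, focusRate, foldAccel]
      simp
      field_simp
      ring
  · ext i
    rw [affine_apply_zero] at hv
    fin_cases i
    · simpa using hx
    · simp [hx, hv]
      field_simp
      ring

/-- Uniqueness: a continuous curve that solves the system inside an interval and starts on a
global solution stays on it. -/
theorem AffineFlow.eqOn (hX : AffineFlow M u X) {c : ℝ → Fin 2 → ℝ} {a b r : ℝ}
    (hc : ContinuousOn c (Icc a b))
    (hd : ∀ t ∈ Ioo a b, HasDerivAt c (M *ᵥ c t + u) t) (h0 : c a = X r) :
    ∀ t ∈ Icc a b, c t = X (r + (t - a)) := by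
  set D0 : ℝ → ℝ := fun t => c t 0 - X (r + (t - a)) 0 with hD0
  set D1 : ℝ → ℝ := fun t => c t 1 - X (r + (t - a)) 1 with hD1
  have hXc : Continuous X := continuous_iff_continuousAt.2 fun t => (hX t).continuousAt
  have hs : ∀ t, HasDerivAt (fun t => X (r + (t - a))) (M *ᵥ X (r + (t - a)) + u) t := by
    intro t
    have h1 : HasDerivAt (fun t : ℝ => r + (t - a)) 1 t :=
      ((hasDerivAt_id t).sub_const a).const_add r
    exact ((hX (r + (t - a))).scomp t h1).congr_deriv (one_smul _ _)
  set C := 2 * (|M 0 0| + |M 0 1| + |M 1 0| + |M 1 1|) with hC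
  -- Gronwall for the squared distance
  set f : ℝ → ℝ := fun t => Real.exp (-C * t) * (D0 t ^ 2 + D1 t ^ 2) with hf
  have hder : ∀ t ∈ Ioo a b, HasDerivAt f (Real.exp (-C * t) * (-C * (D0 t ^ 2 + D1 t ^ 2)
      + 2 * D0 t * (M 0 0 * D0 t + M 0 1 * D1 t)
      + 2 * D1 t * (M 1 0 * D0 t + M 1 1 * D1 t))) t := by
    intro t ht
    have e := Oscillator.hasDerivAt_exp_mul (-C) t
    have h1 := hasDerivAt_pi.1 (hd t ht)
    have h2 := hasDerivAt_pi.1 (hs t)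
    have g0 := (h1 0).sub (h2 0)
    have g1 := (h1 1).sub (h2 1)
    rw [affine_apply_zero, affine_apply_zero] at g0
    rw [affine_apply_one, affine_apply_one] at g1
    refine HasDerivAt.congr_deriv (e.mul ((g0.pow 2).add (g1.pow 2))) ?_
    simp only [hD0, hD1, Pi.sub_apply]
    push_cast
    ring
  have hcont : ContinuousOn f (Icc a b) := by
    have c0 : ContinuousOn D0 (Icc a b) := ((continuous_apply 0).comp_continuousOn hc).sub
      (by fun_prop)
    have c1 : ContinuousOn D1 (Icc a b) := ((continuous_apply 1).comp_continuousOn hc).sub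
      (by fun_prop)
    exact ContinuousOn.mul (by fun_prop) ((c0.pow 2).add (c1.pow 2))
  have hanti : AntitoneOn f (Icc a b) := by
    refine antitoneOn_of_deriv_nonpos (convex_Icc _ _) hcont (fun t ht => ?_) fun t ht => ?_
    · rw [interior_Icc] at ht
      exact (hder t ht).differentiableAt.differentiableWithinAt
    rw [interior_Icc] at ht
    rw [(hder t ht).deriv]
    refine mul_nonpos_of_nonneg_of_nonpos (Real.exp_pos _).le ?_
    have b00 := abs_le.1 (le_refl |M 0 0|)
    have b11 := abs_le.1 (le_refl |M 1 1|)
    have b01 := abs_le.1 (le_refl |M 0 1|)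
    have b10 := abs_le.1 (le_refl |M 1 0|)
    have q0 := sq_nonneg (D0 t)
    have q1 := sq_nonneg (D1 t)
    have cross : ∀ z : ℝ, 2 * (z * (D0 t * D1 t)) ≤ |z| * (D0 t ^ 2 + D1 t ^ 2) := by
      intro z
      have h1 : |D0 t * D1 t| * 2 ≤ D0 t ^ 2 + D1 t ^ 2 := by
        rw [abs_mul]
        nlinarith [sq_nonneg (|D0 t| - |D1 t|), sq_abs (D0 t), sq_abs (D1 t)]
      have h2 := le_abs_self (z * (D0 t * D1 t))
      rw [abs_mul] at h2
      nlinarith [abs_nonneg z]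
    have k1 := cross (M 0 1)
    have k2 := cross (M 1 0)
    have k3 : M 0 0 * D0 t ^ 2 ≤ |M 0 0| * (D0 t ^ 2) := by gcongr; exact le_abs_self _
    have k4 : M 1 1 * D1 t ^ 2 ≤ |M 1 1| * (D1 t ^ 2) := by gcongr; exact le_abs_self _
    have k5 := mul_nonneg (abs_nonneg (M 0 0)) q1
    have k6 := mul_nonneg (abs_nonneg (M 1 1)) q0
    have k7 := mul_nonneg (abs_nonneg (M 0 1)) (add_nonneg q0 q1)
    have k8 := mul_nonneg (abs_nonneg (M 1 0)) (add_nonneg q0 q1)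
    rw [hC]
    nlinarith
  intro t ht
  have hfa : f a = 0 := by simp [hf, hD0, hD1, h0]
  have hle : f t ≤ 0 := hfa ▸ hanti ⟨le_rfl, ht.1.trans ht.2⟩ ht ht.1
  have hsum : D0 t ^ 2 + D1 t ^ 2 ≤ 0 := by
    by_contra hlt
    push Not at hlt
    have := mul_pos (Real.exp_pos (-C * t)) hlt
    simp only [hf] at hle
    linarith
  have z0 : D0 t = 0 := by nlinarith [sq_nonneg (D0 t), sq_nonneg (D1 t)]
  have z1 : D1 t = 0 := by nlinarith [sq_nonneg (D0 t), sq_nonneg (D1 t)]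
  ext i
  fin_cases i
  · exact sub_eq_zero.1 z0
  · exact sub_eq_zero.1 z1

end AffineFlow

/-! ### Time reversal -/

/-- The reflection `(x, y) ↦ (x, -y)`. -/
def flipY (p : Fin 2 → ℝ) : Fin 2 → ℝ := ![p 0, -p 1]

@[simp] theorem flipY_zero (p : Fin 2 → ℝ) : flipY p 0 = p 0 := rfl

@[simp] theorem flipY_one (p : Fin 2 → ℝ) : flipY p 1 = -p 1 := rfl

theorem flipY_injective : Function.Injective flipY := by
  intro p q h
  ext i
  fin_cases i
  · simpa using congrFun h 0
  · simpa using congrFun h 1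

/-- The linear part of the affine field obtained by reversing time and reflecting `y`. -/
def reverseMatrix (M : Matrix (Fin 2) (Fin 2) ℝ) : Matrix (Fin 2) (Fin 2) ℝ :=
  !![-M 0 0, M 0 1; M 1 0, -M 1 1]

/-- The constant part of the affine field obtained by reversing time and reflecting `y`. -/
def reverseVector (u : Fin 2 → ℝ) : Fin 2 → ℝ := ![-u 0, u 1]

theorem reverse_affine (M : Matrix (Fin 2) (Fin 2) ℝ) (u p : Fin 2 → ℝ) :
    reverseMatrix M *ᵥ flipY p + reverseVector u = -flipY (M *ᵥ p + u) := by
  ext i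
  fin_cases i
  · simp [reverseMatrix, reverseVector, flipY]
    ring
  · simp [reverseMatrix, reverseVector, flipY]
    ring

namespace PLField

/-- The field conjugate to `-Z` under the reflection of `y`: its orbits are the reflected orbits of
`Z`, run through backwards. -/
def reverse (Z : PLField) : PLField where
  Mp := reverseMatrix Z.Mp
  up := reverseVector Z.up
  Mm := reverseMatrix Z.Mm
  um := reverseVector Z.um

theorem reverse_reverse (Z : PLField) : Z.reverse.reverse = Z := by
  have hM : ∀ M : Matrix (Fin 2) (Fin 2) ℝ, reverseMatrix (reverseMatrix M) = M := by
    intro M; ext i j; fin_cases i <;> fin_cases j <;> simp [reverseMatrix]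
  have hu : ∀ u : Fin 2 → ℝ, reverseVector (reverseVector u) = u := by
    intro u; ext i; fin_cases i <;> simp [reverseVector]
  simp [reverse, hM, hu]

theorem reverse_plus (Z : PLField) (p : Fin 2 → ℝ) :
    Z.reverse.plus (flipY p) = -flipY (Z.plus p) := reverse_affine _ _ _

theorem reverse_minus (Z : PLField) (p : Fin 2 → ℝ) :
    Z.reverse.minus (flipY p) = -flipY (Z.minus p) := reverse_affine _ _ _

theorem reverse_slide (Z : PLField) (p : Fin 2 → ℝ) :
    Z.reverse.slide (flipY p) = -flipY (Z.slide p) := by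
  have h : (-Z.minus p 0 - -Z.plus p 0)⁻¹ = -(Z.minus p 0 - Z.plus p 0)⁻¹ := by
    rw [← inv_neg]; congr 1; ring
  ext i
  simp only [slide, reverse_plus, reverse_minus, Pi.neg_apply, flipY_zero, h]
  fin_cases i
  · simp
  · simp
    ring

end PLField

/-- The kind of an arc after time reversal: sliding and escaping arcs are exchanged. -/
def ArcKind.reverse : ArcKind → ArcKind
  | .plus => .plus
  | .minus => .minus
  | .sliding => .escaping
  | .escaping => .sliding

theorem ArcKind.reverse_field (Z : PLField) (k : ArcKind) (p : Fin 2 → ℝ) :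
    k.reverse.field Z.reverse (flipY p) = -flipY (k.field Z p) := by
  cases k
  · exact Z.reverse_plus p
  · exact Z.reverse_minus p
  · exact Z.reverse_slide p
  · exact Z.reverse_slide p

theorem ArcKind.reverse_region (Z : PLField) (k : ArcKind) {p : Fin 2 → ℝ} (hp : p ∈ k.region Z) :
    flipY p ∈ k.reverse.region Z.reverse := by
  cases k
  · exact hp
  · exact hp
  · refine ⟨hp.1, ?_, ?_⟩
    · rw [Z.reverse_plus]; simpa using hp.2.1
    · rw [Z.reverse_minus]; simpa using hp.2.2
  · refine ⟨hp.1, ?_, ?_⟩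
    · rw [Z.reverse_plus]; simpa using hp.2.1
    · rw [Z.reverse_minus]; simpa using hp.2.2

theorem hasDerivAt_flipY {c : ℝ → Fin 2 → ℝ} {c' : Fin 2 → ℝ} {t : ℝ} (h : HasDerivAt c c' t) :
    HasDerivAt (fun t => flipY (c t)) (flipY c') t := by
  rw [hasDerivAt_pi] at h ⊢
  intro i
  fin_cases i
  · exact h 0
  · exact (h 1).neg

theorem continuous_flipY : Continuous flipY := by
  refine continuous_pi fun i => ?_
  fin_cases i
  · exact continuous_apply 0
  · exact (continuous_apply 1).neg

namespace ClosedTrajectory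

variable {Z : PLField}

/-- The reflected trajectory, run through backwards. -/
def reverse (γ : ClosedTrajectory Z) : ClosedTrajectory Z.reverse where
  n := γ.n
  n_pos := γ.n_pos
  time i := -γ.time i.rev
  time_strictMono i j hij := neg_lt_neg (γ.time_strictMono (Fin.rev_lt_rev.2 hij))
  kind i := (γ.kind i.rev).reverse
  curve t := flipY (γ.curve (-t))
  continuousOn := by
    refine continuous_flipY.comp_continuousOn (γ.continuousOn.comp (by fun_prop) fun t ht => ?_)
    rw [Fin.rev_zero, Fin.rev_last] at ht
    exact ⟨by linarith [ht.2], by linarith [ht.1]⟩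
  closed := by
    rw [Fin.rev_zero, Fin.rev_last, neg_neg, neg_neg, γ.closed]
  mem_region i t ht := by
    rw [Fin.rev_castSucc, Fin.rev_succ] at ht
    exact ArcKind.reverse_region Z _
      (γ.mem_region i.rev (-t) ⟨by linarith [ht.2], by linarith [ht.1]⟩)
  hasDerivAt i t ht := by
    rw [Fin.rev_castSucc, Fin.rev_succ] at ht
    have h := γ.hasDerivAt i.rev (-t) ⟨by linarith [ht.2], by linarith [ht.1]⟩
    rw [ArcKind.reverse_field]
    have h2 := hasDerivAt_flipY (h.scomp t (hasDerivAt_neg t))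
    refine h2.congr_deriv ?_
    ext i
    fin_cases i <;> simp

theorem reverse_uses (γ : ClosedTrajectory Z) (k : ArcKind) :
    γ.reverse.Uses k.reverse ↔ γ.Uses k := by
  have hinj : ∀ a b : ArcKind, a.reverse = b.reverse → a = b := by
    intro a b; cases a <;> cases b <;> simp [ArcKind.reverse]
  constructor
  · rintro ⟨i, hi⟩
    exact ⟨i.rev, hinj _ _ hi⟩
  · rintro ⟨i, hi⟩
    refine ⟨Fin.rev i, ?_⟩
    change (γ.kind i.rev.rev).reverse = _
    rw [Fin.rev_rev, hi]

theorem IsSimple.reverse {γ : ClosedTrajectory Z} (h : γ.IsSimple) : γ.reverse.IsSimple := by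
  have hlt : γ.time 0 < γ.time (Fin.last γ.n) :=
    γ.time_strictMono (Fin.lt_def.2 (by simpa using γ.n_pos))
  -- move the final time to the initial time
  have key : ∀ s ∈ Ioc (γ.time 0) (γ.time (Fin.last γ.n)),
      ∀ t ∈ Ioc (γ.time 0) (γ.time (Fin.last γ.n)), s ≤ t → γ.curve s = γ.curve t → s = t := by
    intro s hs t ht hst heq
    rcases ht.2.eq_or_lt with rfl | htl
    · rcases hst.eq_or_lt with rfl | hsl
      · rfl
      rw [← γ.closed] at heq
      have := h ⟨hs.1.le, hsl⟩ ⟨le_rfl, hlt⟩ heq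
      exact absurd this hs.1.ne'
    · exact h ⟨hs.1.le, hst.trans_lt htl⟩ ⟨ht.1.le, htl⟩ heq
  intro s hs t ht heq
  change s ∈ Ico (-γ.time (Fin.rev 0)) (-γ.time (Fin.rev (Fin.last γ.n))) at hs
  change t ∈ Ico (-γ.time (Fin.rev 0)) (-γ.time (Fin.rev (Fin.last γ.n))) at ht
  rw [Fin.rev_zero, Fin.rev_last] at hs ht
  have heq' : γ.curve (-s) = γ.curve (-t) := flipY_injective heq
  have hs' : -s ∈ Ioc (γ.time 0) (γ.time (Fin.last γ.n)) :=
    ⟨by linarith [hs.2], by linarith [hs.1]⟩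
  have ht' : -t ∈ Ioc (γ.time 0) (γ.time (Fin.last γ.n)) :=
    ⟨by linarith [ht.2], by linarith [ht.1]⟩
  rcases le_total (-s) (-t) with hle | hle
  · linarith [key _ hs' _ ht' hle heq']
  · linarith [key _ ht' _ hs' hle heq'.symm]

theorem IsProperSlidingCycle.reverse {γ : ClosedTrajectory Z} (h : γ.IsProperSlidingCycle) :
    γ.reverse.IsProperEscapingCycle :=
  ⟨h.1.reverse, ⟨(γ.reverse_uses .sliding).2 h.2.1.1,
    h.2.1.2.imp (γ.reverse_uses .plus).2 (γ.reverse_uses .minus).2⟩,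
    fun hs => h.2.2 ((γ.reverse_uses .escaping).1 hs)⟩

theorem IsTypeI.reverse {γ : ClosedTrajectory Z} (h : γ.IsTypeI) : γ.reverse.IsTypeI := by
  have hp := γ.reverse_uses .plus
  have hm := γ.reverse_uses .minus
  simp only [ArcKind.reverse] at hp hm
  unfold IsTypeI at h ⊢
  rwa [hp, hm]

theorem IsTypeII.reverse {γ : ClosedTrajectory Z} (h : γ.IsTypeII) : γ.reverse.IsTypeII :=
  ⟨(γ.reverse_uses .plus).2 h.1, (γ.reverse_uses .minus).2 h.2⟩

end ClosedTrajectory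

/-- The reversed field has an escaping cycle wherever the field has a sliding cycle. -/
theorem exists_escaping_of_reverse {Z : PLField}
    {P : ∀ {W : PLField}, ClosedTrajectory W → Prop}
    (hP : ∀ {W : PLField} {γ : ClosedTrajectory W}, P γ → P γ.reverse)
    (h : ∃ γ : ClosedTrajectory Z.reverse, γ.IsProperSlidingCycle ∧ P γ) :
    ∃ γ : ClosedTrajectory Z, γ.IsProperEscapingCycle ∧ P γ := by
  obtain ⟨γ, h1, h2⟩ := h
  rw [← Z.reverse_reverse]
  exact ⟨γ.reverse, h1.reverse, hP h2⟩

/-- Absence of sliding and escaping cycles is invariant under time reversal. -/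
theorem no_cycle_of_reverse {Z : PLField}
    (h : ∀ γ : ClosedTrajectory Z.reverse, ¬ γ.IsSlidingCycle ∧ ¬ γ.IsEscapingCycle)
    (γ : ClosedTrajectory Z) : ¬ γ.IsSlidingCycle ∧ ¬ γ.IsEscapingCycle := by
  have hor : γ.Uses .plus ∨ γ.Uses .minus → γ.reverse.Uses .plus ∨ γ.reverse.Uses .minus :=
    Or.imp (γ.reverse_uses .plus).2 (γ.reverse_uses .minus).2
  exact ⟨fun hs => (h γ.reverse).2 ⟨(γ.reverse_uses .sliding).2 hs.1, hor hs.2⟩,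
    fun hs => (h γ.reverse).1 ⟨(γ.reverse_uses .escaping).2 hs.1, hor hs.2⟩⟩

/-! ### Absence of sliding and escaping cycles -/

/-- On `[a, b]` the curve `c` is an arc of kind `k`. -/
structure IsArc (Z : PLField) (k : ArcKind) (c : ℝ → Fin 2 → ℝ) (a b : ℝ) : Prop where
  lt : a < b
  continuousOn : ContinuousOn c (Icc a b)
  mem_region : ∀ t ∈ Ioo a b, c t ∈ k.region Z
  hasDerivAt : ∀ t ∈ Ioo a b, HasDerivAt c (k.field Z (c t)) t

theorem IsArc.mem_of_isClosed {Z : PLField} {k : ArcKind} {c : ℝ → Fin 2 → ℝ} {a b : ℝ}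
    (h : IsArc Z k c a b) {S : Set (Fin 2 → ℝ)} (hS : IsClosed S) (hk : k.region Z ⊆ S) :
    ∀ t ∈ Icc a b, c t ∈ S := by
  have h1 : MapsTo c (Ioo a b) S := fun t ht => hk (h.mem_region t ht)
  have h2 := h1.closure_of_continuousOn (by rw [closure_Ioo h.lt.ne]; exact h.continuousOn)
  rwa [closure_Ioo h.lt.ne, hS.closure_eq] at h2

theorem IsArc.plus_nonneg {Z : PLField} {c : ℝ → Fin 2 → ℝ} {a b : ℝ}
    (h : IsArc Z .plus c a b) : ∀ t ∈ Icc a b, 0 ≤ c t 0 := by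
  have hk : ArcKind.plus.region Z ⊆ {p | 0 ≤ p 0} := fun p (hp : 0 < p 0) => hp.le
  exact h.mem_of_isClosed (isClosed_le continuous_const (continuous_apply 0)) hk

theorem IsArc.minus_nonpos {Z : PLField} {c : ℝ → Fin 2 → ℝ} {a b : ℝ}
    (h : IsArc Z .minus c a b) : ∀ t ∈ Icc a b, c t 0 ≤ 0 := by
  have hk : ArcKind.minus.region Z ⊆ {p | p 0 ≤ 0} := fun p (hp : p 0 < 0) => hp.le
  exact h.mem_of_isClosed (isClosed_le (continuous_apply 0) continuous_const) hk

theorem ClosedTrajectory.isArc {Z : PLField} (γ : ClosedTrajectory Z) (i : Fin γ.n) :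
    IsArc Z (γ.kind i) γ.curve (γ.time i.castSucc) (γ.time i.succ) where
  lt := γ.time_strictMono (Fin.castSucc_lt_succ)
  continuousOn := γ.continuousOn.mono
    (Icc_subset_Icc (γ.time_strictMono.monotone (Fin.zero_le _))
      (γ.time_strictMono.monotone (Fin.le_last _)))
  mem_region := γ.mem_region i
  hasDerivAt := γ.hasDerivAt i

/-- An oscillator at rest at `0`, to the right of its equilibrium, cannot move to the right. -/
theorem Oscillator.not_pos_of_rest {α ω κ : ℝ} {x v : ℝ → ℝ} (h : Oscillator α ω κ x v)
    (hκ : κ < 0) (hx0 : x 0 = 0) (hv0 : v 0 = 0) {r : ℝ} (hr : 0 < r) :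
    ¬ ∀ t ∈ Ioo 0 r, 0 < x t := by
  intro hpos
  have h1 := (hasDerivAt_iff_tendsto_slope_left_right.1 (h.dv 0)).2
  have hneg : 2 * α * v 0 - (α ^ 2 + ω ^ 2) * x 0 + κ < 0 := by rw [hv0, hx0]; simpa using hκ
  have h2 := h1.eventually_lt_const hneg
  obtain ⟨η, hη, hηs⟩ := mem_nhdsGT_iff_exists_Ioo_subset.1 h2
  have hη0 : 0 < η := hη
  have hanti : StrictAntiOn x (Icc 0 (min η r)) := by
    refine strictAntiOn_of_deriv_neg (convex_Icc _ _) h.continuous_x.continuousOn fun t ht => ?_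
    rw [interior_Icc] at ht
    rw [(h.dx t).deriv]
    have := hηs ⟨ht.1, ht.2.trans_le (min_le_left _ _)⟩
    simp only [mem_ofPred_eq, slope_def_field, hv0, sub_zero] at this
    rw [div_neg_iff] at this
    rcases this with ⟨_, h3⟩ | ⟨h3, _⟩
    · linarith [ht.1]
    · exact h3
  have hm : 0 < min η r := lt_min hη0 hr
  have hlt := hanti ⟨le_rfl, hm.le⟩ ⟨by positivity, by linarith⟩ (half_pos hm)
  have hle := hpos (min η r / 2) ⟨by positivity, by linarith [min_le_right η r]⟩
  linarith

namespace PLField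

variable (Z : PLField)

/-- The ordinate of the fold of `Z⁻`. -/
noncomputable def foldMinus : ℝ := foldPoint Z.Mm Z.um

/-- The ordinate of the fold of `Z⁺`. -/
noncomputable def foldPlus : ℝ := foldPoint Z.Mp Z.up

/-- Both fields are foci with equilibrium to the left of the switching line. -/
structure IsFocusPair : Prop where
  plus : IsFocus Z.Mp Z.up
  minus : IsFocus Z.Mm Z.um

variable {Z}

theorem IsFocusPair.plus_normal (h : Z.IsFocusPair) {p : Fin 2 → ℝ} (hp : p 0 = 0) :
    Z.plus p 0 = Z.Mp 0 1 * (p 1 - Z.foldPlus) := h.plus.normal_velocity hp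

theorem IsFocusPair.minus_normal (h : Z.IsFocusPair) {p : Fin 2 → ℝ} (hp : p 0 = 0) :
    Z.minus p 0 = Z.Mm 0 1 * (p 1 - Z.foldMinus) := h.minus.normal_velocity hp

theorem IsFocusPair.mem_slidingRegion (h : Z.IsFocusPair) {p : Fin 2 → ℝ} :
    p ∈ Z.slidingRegion ↔ p 0 = 0 ∧ Z.foldPlus < p 1 ∧ p 1 < Z.foldMinus := by
  have hp := h.plus.coupling
  have hm := h.minus.coupling
  refine and_congr_right fun h0 => ?_
  rw [h.plus_normal h0, h.minus_normal h0, mul_neg_iff, mul_pos_iff]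
  constructor
  · rintro ⟨h1 | h1, h2 | h2⟩ <;> constructor <;> linarith [h1.1, h1.2, h2.1, h2.2]
  · rintro ⟨h1, h2⟩
    exact ⟨Or.inr ⟨hp, by linarith⟩, Or.inr ⟨hm, by linarith⟩⟩

theorem IsFocusPair.mem_escapingRegion (h : Z.IsFocusPair) {p : Fin 2 → ℝ} :
    p ∈ Z.escapingRegion ↔ p 0 = 0 ∧ Z.foldMinus < p 1 ∧ p 1 < Z.foldPlus := by
  have hp := h.plus.coupling
  have hm := h.minus.coupling
  refine and_congr_right fun h0 => ?_
  rw [h.plus_normal h0, h.minus_normal h0, mul_neg_iff, mul_pos_iff]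
  constructor
  · rintro ⟨h1 | h1, h2 | h2⟩ <;> constructor <;> linarith [h1.1, h1.2, h2.1, h2.2]
  · rintro ⟨h1, h2⟩
    exact ⟨Or.inr ⟨hp, by linarith⟩, Or.inr ⟨hm, by linarith⟩⟩

variable (Z)

/-- The segment between the two folds, which is the closure of the sliding or escaping region. -/
def foldSegment : Set (Fin 2 → ℝ) :=
  {p | p 0 = 0 ∧ min Z.foldMinus Z.foldPlus ≤ p 1 ∧ p 1 ≤ max Z.foldMinus Z.foldPlus}

/-- The points off the fold segment on an excursion of `Z⁻` from above its fold. -/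
def MinusTrap (p : Fin 2 → ℝ) : Prop :=
  ∃ X s, AffineFlow Z.Mm Z.um X ∧ X 0 0 = 0 ∧ Z.foldMinus ≤ X 0 1 ∧ 0 ≤ s ∧
    (∀ t ∈ Ioc 0 s, X t 0 < 0) ∧ X s = p ∧ (0 < s ∨ max Z.foldMinus Z.foldPlus < X 0 1)

/-- The points off the fold segment on an excursion of `Z⁺` that starts in the fold segment, or at
distance at least `g` below the fold of `Z⁻`. -/
def PlusTrap (g : ℝ) (p : Fin 2 → ℝ) : Prop :=
  ∃ X s, AffineFlow Z.Mp Z.up X ∧ X 0 0 = 0 ∧ X 0 1 < Z.foldPlus ∧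
    (X 0 1 ≤ Z.foldMinus - g ∨ min Z.foldMinus Z.foldPlus ≤ X 0 1) ∧ 0 ≤ s ∧
    (∀ t ∈ Ioc 0 s, 0 < X t 0) ∧ X s = p ∧ (0 < s ∨ X 0 1 < min Z.foldMinus Z.foldPlus)

/-- The part of the phase plane which an orbit that has left the fold segment never leaves. -/
def Trap (g : ℝ) (p : Fin 2 → ℝ) : Prop := Z.MinusTrap p ∨ Z.PlusTrap g p

/-- The focus of `Z⁻` is unstable, so strongly that its excursions end at distance at least `g`
below its fold, where `g` is large compared with the distance of the folds, while the contraction of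
the excursions of `Z⁺` is moderate. -/
structure IsRepelling (g : ℝ) : Prop where
  pair : Z.IsFocusPair
  rate : 0 < focusRate Z.Mm
  gap : 3 * |Z.foldMinus - Z.foldPlus| < g
  landing : (Z.Mm 0 1 * g) ^ 2 ≤ 8 * focusRate Z.Mm *
    (foldAccel Z.Mm Z.um / (focusRate Z.Mm ^ 2 + focusFreq Z.Mm ^ 2)) ^ 2 * focusFreq Z.Mm / Real.pi
  contraction : 1 / 2 ≤ Real.exp (-(2 * |focusRate Z.Mp| * (Real.pi / focusFreq Z.Mp)))

variable {Z} {g : ℝ}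

theorem IsRepelling.gap_lt (h : Z.IsRepelling g) :
    Z.foldMinus - g < min Z.foldMinus Z.foldPlus := by
  have h1 := h.gap
  have h2 := abs_le.1 (le_refl |Z.foldMinus - Z.foldPlus|)
  have h3 := abs_nonneg (Z.foldMinus - Z.foldPlus)
  exact lt_min (by linarith) (by linarith)

theorem IsRepelling.minus_landing (h : Z.IsRepelling g) {X : ℝ → Fin 2 → ℝ}
    (hX : AffineFlow Z.Mm Z.um X) (h0 : X 0 0 = 0) {s : ℝ} (hs : 0 < s)
    (hneg : ∀ t ∈ Ioo 0 s, X t 0 < 0) (hXs : X s 0 = 0) : X s 1 ≤ Z.foldMinus - g := by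
  have hm := h.pair.minus
  obtain ⟨h1, h2⟩ := (hX.oscillator hm).landing_of_neg hm.freq_pos h.rate hm.accel h0 hs hneg hXs
  have h3 := h.landing.trans h2
  rw [hm.normal_velocity hXs] at h1 h3
  have hc := hm.coupling
  have h4 : -(Z.Mm 0 1 * g) ≤ Z.Mm 0 1 * (X s 1 - foldPoint Z.Mm Z.um) := by
    have := abs_le_of_sq_le_sq h3 h1
    linarith [(abs_le.1 this).1]
  have : Z.Mm 0 1 * (X s 1 - foldPoint Z.Mm Z.um + g) ≥ 0 := by linarith
  have := nonpos_of_mul_nonneg_right this hc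
  change X s 1 ≤ foldPoint Z.Mm Z.um - g
  linarith

theorem IsRepelling.plus_landing (h : Z.IsRepelling g) {X : ℝ → Fin 2 → ℝ}
    (hX : AffineFlow Z.Mp Z.up X) (h0 : X 0 0 = 0) (hlt : X 0 1 < Z.foldPlus)
    (hy : X 0 1 ≤ Z.foldMinus - g ∨ min Z.foldMinus Z.foldPlus ≤ X 0 1) {s : ℝ} (hs : 0 < s)
    (hpos : ∀ t ∈ Ioo 0 s, 0 < X t 0) (hXs : X s 0 = 0) :
    max Z.foldMinus Z.foldPlus < X s 1 := by
  have hp := h.pair.plus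
  have hc := hp.coupling
  have hv0 : 0 < (Z.Mp *ᵥ X 0 + Z.up) 0 := by
    rw [hp.normal_velocity h0]
    exact mul_pos_of_neg_of_neg hc (sub_neg.2 hlt)
  have h1 := ((hX.oscillator hp).landing_of_pos hp.freq_pos hp.accel h0 hv0 hs hpos hXs).1
  have hq := h.contraction
  set q := Real.exp (-(2 * |focusRate Z.Mp| * (Real.pi / focusFreq Z.Mp)))
  rw [hp.normal_velocity h0, hp.normal_velocity hXs] at h1
  change Z.Mp 0 1 * (X 0 1 - Z.foldPlus) * q ≤ -(Z.Mp 0 1 * (X s 1 - Z.foldPlus)) at h1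
  have h2 : (Z.foldPlus - X 0 1) * q ≤ X s 1 - Z.foldPlus := by
    have : 0 ≤ Z.Mp 0 1 * ((Z.foldPlus - X 0 1) * q - (X s 1 - Z.foldPlus)) := by linarith
    linarith [nonpos_of_mul_nonneg_right this hc]
  have h3 : (Z.foldPlus - X 0 1) * (1 / 2) ≤ X s 1 - Z.foldPlus :=
    (mul_le_mul_of_nonneg_left hq (by linarith)).trans h2
  rcases hy with hy | hy
  · have h4 := h.gap
    have h5 := abs_le.1 (le_refl |Z.foldMinus - Z.foldPlus|)
    exact max_lt (by linarith) (by linarith)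
  · have : Z.foldMinus < Z.foldPlus := by
      by_contra hge
      push Not at hge
      rw [min_eq_right hge] at hy
      linarith
    rw [max_eq_right this.le]
    linarith

variable {k : ArcKind} {c : ℝ → Fin 2 → ℝ} {a b : ℝ}

/-- Continuation of an excursion of `Z⁻`. -/
theorem IsRepelling.minus_step (h : Z.IsRepelling g) (hc : IsArc Z .minus c a b)
    {X : ℝ → Fin 2 → ℝ} {r : ℝ} (hX : AffineFlow Z.Mm Z.um X) (h0 : X 0 0 = 0)
    (hy : Z.foldMinus ≤ X 0 1) (hr : 0 ≤ r) (hneg : ∀ t ∈ Ioc 0 r, X t 0 < 0) (hXr : X r = c a) :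
    Z.Trap g (c b) := by
  have heq := hX.eqOn hc.continuousOn hc.hasDerivAt hXr.symm
  have hab := hc.lt
  set s := r + (b - a) with hs
  have hs0 : 0 < s := by linarith
  have hcb : X s = c b := (heq b ⟨hab.le, le_rfl⟩).symm
  have hneg' : ∀ t ∈ Ioo 0 s, X t 0 < 0 := by
    intro t ht
    rcases le_or_gt t r with htr | htr
    · exact hneg t ⟨ht.1, htr⟩
    · have h1 := hc.mem_region (a + (t - r)) ⟨by linarith, by linarith [ht.2]⟩
      rw [heq _ ⟨by linarith, by linarith [ht.2]⟩] at h1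
      have e : r + (a + (t - r) - a) = t := by ring
      rw [e] at h1
      exact h1
  have hle : X s 0 ≤ 0 := by
    rw [hcb]
    exact hc.minus_nonpos b ⟨hab.le, le_rfl⟩
  rcases hle.lt_or_eq with hlt | hz
  · refine Or.inl ⟨X, s, hX, h0, hy, hs0.le, fun t ht => ?_, hcb, Or.inl hs0⟩
    rcases ht.2.eq_or_lt with rfl | hts
    · exact hlt
    · exact hneg' t ⟨ht.1, hts⟩
  · have hl := h.minus_landing hX h0 hs0 hneg' hz
    have hg := h.gap_lt
    obtain ⟨Y, hY, hY0⟩ := h.pair.plus.exists_flow (c b)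
    rw [← hcb] at hY0
    refine Or.inr ⟨Y, 0, hY, by rw [hY0, hz], ?_, Or.inl (by rw [hY0]; exact hl), le_rfl,
      fun t ht => absurd (ht.1.trans_le ht.2) (lt_irrefl _), by rw [hY0, hcb], Or.inr ?_⟩
    · rw [hY0]; exact (hl.trans_lt hg).trans_le (min_le_right _ _)
    · rw [hY0]; exact hl.trans_lt hg

/-- Continuation of an excursion of `Z⁺`. -/
theorem IsRepelling.plus_step (h : Z.IsRepelling g) (hc : IsArc Z .plus c a b)
    {X : ℝ → Fin 2 → ℝ} {r : ℝ} (hX : AffineFlow Z.Mp Z.up X) (h0 : X 0 0 = 0)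
    (hlt : X 0 1 < Z.foldPlus)
    (hy : X 0 1 ≤ Z.foldMinus - g ∨ min Z.foldMinus Z.foldPlus ≤ X 0 1)
    (hr : 0 ≤ r) (hpos : ∀ t ∈ Ioc 0 r, 0 < X t 0) (hXr : X r = c a) :
    Z.Trap g (c b) := by
  have heq := hX.eqOn hc.continuousOn hc.hasDerivAt hXr.symm
  have hab := hc.lt
  set s := r + (b - a) with hs
  have hs0 : 0 < s := by linarith
  have hcb : X s = c b := (heq b ⟨hab.le, le_rfl⟩).symm
  have hpos' : ∀ t ∈ Ioo 0 s, 0 < X t 0 := by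
    intro t ht
    rcases le_or_gt t r with htr | htr
    · exact hpos t ⟨ht.1, htr⟩
    · have h1 := hc.mem_region (a + (t - r)) ⟨by linarith, by linarith [ht.2]⟩
      rw [heq _ ⟨by linarith, by linarith [ht.2]⟩] at h1
      have e : r + (a + (t - r) - a) = t := by ring
      rw [e] at h1
      exact h1
  have hle : 0 ≤ X s 0 := by
    rw [hcb]
    exact hc.plus_nonneg b ⟨hab.le, le_rfl⟩
  rcases hle.lt_or_eq with hlt' | hz
  · refine Or.inr ⟨X, s, hX, h0, hlt, hy, hs0.le, fun t ht => ?_, hcb, Or.inl hs0⟩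
    rcases ht.2.eq_or_lt with rfl | hts
    · exact hlt'
    · exact hpos' t ⟨ht.1, hts⟩
  · have hl := h.plus_landing hX h0 hlt hy hs0 hpos' hz.symm
    obtain ⟨Y, hY, hY0⟩ := h.pair.minus.exists_flow (c b)
    rw [← hcb] at hY0
    refine Or.inl ⟨Y, 0, hY, by rw [hY0, hz], ?_, le_rfl,
      fun t ht => absurd (ht.1.trans_le ht.2) (lt_irrefl _), by rw [hY0, hcb], Or.inr ?_⟩
    · rw [hY0]; exact (le_max_left _ _).trans hl.le
    · rw [hY0]; exact hl

/-- An arc of `Z⁻` can leave the switching line only above the fold, or at it. -/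
theorem IsFocusPair.minus_start (h : Z.IsFocusPair) (hc : IsArc Z .minus c a b)
    (h0 : c a 0 = 0) : Z.foldMinus ≤ c a 1 := by
  obtain ⟨X, hX, hX0⟩ := h.minus.exists_flow (c a)
  have heq := hX.eqOn hc.continuousOn hc.hasDerivAt hX0.symm
  have h00 : X 0 0 = 0 := by rw [hX0, h0]
  have hd := ((hX.oscillator h.minus).dx 0).nonpos_of_neg_right (sub_pos.2 hc.lt)
    (fun t ht => by
      have h1 := hc.mem_region (a + t) ⟨by linarith [ht.1], by linarith [ht.2]⟩
      rw [heq _ ⟨by linarith [ht.1], by linarith [ht.2]⟩] at h1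
      have e : 0 + (a + t - a) = t := by ring
      rw [e] at h1
      exact h1) h00
  rw [h.minus.normal_velocity h00, hX0] at hd
  have := nonneg_of_mul_nonpos_right hd h.minus.coupling
  change foldPoint _ _ ≤ _
  linarith

/-- An arc of `Z⁺` can leave the switching line only strictly below the fold, the fold being
invisible. -/
theorem IsFocusPair.plus_start (h : Z.IsFocusPair) (hc : IsArc Z .plus c a b)
    (h0 : c a 0 = 0) : c a 1 < Z.foldPlus := by
  obtain ⟨X, hX, hX0⟩ := h.plus.exists_flow (c a)
  have heq := hX.eqOn hc.continuousOn hc.hasDerivAt hX0.symm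
  have h00 : X 0 0 = 0 := by rw [hX0, h0]
  have ho := hX.oscillator h.plus
  have hpos : ∀ t ∈ Ioo 0 (b - a), 0 < X t 0 := by
    intro t ht
    have h1 := hc.mem_region (a + t) ⟨by linarith [ht.1], by linarith [ht.2]⟩
    rw [heq _ ⟨by linarith [ht.1], by linarith [ht.2]⟩] at h1
    have e : 0 + (a + t - a) = t := by ring
    rw [e] at h1
    exact h1
  have hd := (ho.dx 0).neg.nonpos_of_neg_right (sub_pos.2 hc.lt)
    (fun t ht => by simpa using hpos t ht) (by simp [h00])
  have hne : (Z.Mp *ᵥ X 0 + Z.up) 0 ≠ 0 := fun hz =>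
    ho.not_pos_of_rest h.plus.accel h00 hz (sub_pos.2 hc.lt) hpos
  have hgt : 0 < (Z.Mp *ᵥ X 0 + Z.up) 0 := lt_of_le_of_ne (by linarith) hne.symm
  rw [h.plus.normal_velocity h00, hX0] at hgt
  have := (neg_iff_neg_of_mul_pos hgt).1 h.plus.coupling
  change _ < foldPoint _ _
  linarith

theorem IsFocusPair.mem_foldSegment (h : Z.IsFocusPair) (hc : IsArc Z k c a b)
    (hk : k = .sliding ∨ k = .escaping) : ∀ t ∈ Icc a b, c t ∈ Z.foldSegment := by
  refine hc.mem_of_isClosed ?_ fun p hp => ?_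
  · refine (isClosed_eq (continuous_apply 0) continuous_const).inter
      ((isClosed_le continuous_const (continuous_apply 1)).inter
        (isClosed_le (continuous_apply 1) continuous_const))
  · rcases hk with rfl | rfl
    · obtain ⟨h0, h1, h2⟩ := h.mem_slidingRegion.1 hp
      exact ⟨h0, (min_le_right _ _).trans h1.le, h2.le.trans (le_max_left _ _)⟩
    · obtain ⟨h0, h1, h2⟩ := h.mem_escapingRegion.1 hp
      exact ⟨h0, (min_le_left _ _).trans h1.le, h2.le.trans (le_max_right _ _)⟩

theorem not_mem_foldSegment_of_trap {p : Fin 2 → ℝ} (hp : Z.Trap g p) : p ∉ Z.foldSegment := by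
  rintro ⟨h0, h1, h2⟩
  rcases hp with ⟨X, s, -, -, -, hs, hneg, rfl, hor⟩ | ⟨X, s, -, -, -, -, hs, hpos, rfl, hor⟩
  · rcases hs.eq_or_lt with rfl | hs
    · rcases hor with hor | hor
      · exact lt_irrefl _ hor
      · linarith
    · linarith [hneg s ⟨hs, le_rfl⟩]
  · rcases hs.eq_or_lt with rfl | hs
    · rcases hor with hor | hor
      · exact lt_irrefl _ hor
      · linarith
    · linarith [hpos s ⟨hs, le_rfl⟩]

/-- The trap is forward invariant. -/
theorem IsRepelling.trap_step (h : Z.IsRepelling g) (hc : IsArc Z k c a b)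
    (ha : Z.Trap g (c a)) : Z.Trap g (c b) := by
  have hmem : a ∈ Icc a b := ⟨le_rfl, hc.lt.le⟩
  cases k with
  | sliding =>
    exact absurd (h.pair.mem_foldSegment hc (Or.inl rfl) a hmem) (not_mem_foldSegment_of_trap ha)
  | escaping =>
    exact absurd (h.pair.mem_foldSegment hc (Or.inr rfl) a hmem) (not_mem_foldSegment_of_trap ha)
  | plus =>
    have hge : 0 ≤ c a 0 := hc.plus_nonneg a hmem
    rcases ha with ⟨X, s, hX, h0, hy, hs, hneg, hXs, hor⟩ |
      ⟨X, s, hX, h0, hlt, hy, hs, hpos, hXs, -⟩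
    · rcases hs.eq_or_lt with rfl | hs
      · have h1 := h.pair.plus_start hc (by rw [← hXs, h0])
        rw [← hXs] at h1
        rcases hor with hor | hor
        · exact absurd hor (lt_irrefl _)
        · linarith [le_max_right Z.foldMinus Z.foldPlus]
      · have := hneg s ⟨hs, le_rfl⟩
        rw [hXs] at this
        linarith
    · exact h.plus_step hc hX h0 hlt hy hs hpos hXs
  | minus =>
    have hle : c a 0 ≤ 0 := hc.minus_nonpos a hmem
    rcases ha with ⟨X, s, hX, h0, hy, hs, hneg, hXs, -⟩ |
      ⟨X, s, hX, h0, hlt, hy, hs, hpos, hXs, hor⟩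
    · exact h.minus_step hc hX h0 hy hs hneg hXs
    · rcases hs.eq_or_lt with rfl | hs
      · have h1 := h.pair.minus_start hc (by rw [← hXs, h0])
        rw [← hXs] at h1
        rcases hor with hor | hor
        · exact absurd hor (lt_irrefl _)
        · linarith [min_le_left Z.foldMinus Z.foldPlus]
      · have := hpos s ⟨hs, le_rfl⟩
        rw [hXs] at this
        linarith

/-- An orbit that leaves the fold segment enters the trap. -/
theorem IsRepelling.segment_step (h : Z.IsRepelling g) (hc : IsArc Z k c a b)
    (ha : c a ∈ Z.foldSegment) :
    ((k = .sliding ∨ k = .escaping) ∧ c b ∈ Z.foldSegment) ∨ Z.Trap g (c b) := by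
  have hb : b ∈ Icc a b := ⟨hc.lt.le, le_rfl⟩
  obtain ⟨h0, h1, h2⟩ := ha
  cases k with
  | sliding => exact Or.inl ⟨Or.inl rfl, h.pair.mem_foldSegment hc (Or.inl rfl) b hb⟩
  | escaping => exact Or.inl ⟨Or.inr rfl, h.pair.mem_foldSegment hc (Or.inr rfl) b hb⟩
  | plus =>
    right
    have hs := h.pair.plus_start hc h0
    obtain ⟨X, hX, hX0⟩ := h.pair.plus.exists_flow (c a)
    exact h.plus_step hc hX (by rw [hX0, h0]) (by rw [hX0]; exact hs)
      (Or.inr (by rw [hX0]; exact h1)) le_rfl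
      (fun t ht => absurd (ht.1.trans_le ht.2) (lt_irrefl _)) hX0
  | minus =>
    right
    have hs := h.pair.minus_start hc h0
    obtain ⟨X, hX, hX0⟩ := h.pair.minus.exists_flow (c a)
    exact h.minus_step hc hX (by rw [hX0, h0]) (by rw [hX0]; exact hs) le_rfl
      (fun t ht => absurd (ht.1.trans_le ht.2) (lt_irrefl _)) hX0

end PLField

/-- A property that is passed on from the beginning to the end of each arc of a closed trajectory
holds at all junctions or at none. -/
theorem ClosedTrajectory.forall_of_exists {Z : PLField} (γ : ClosedTrajectory Z)
    {Q : (Fin 2 → ℝ) → Prop}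
    (hQ : ∀ i : Fin γ.n, Q (γ.curve (γ.time i.castSucc)) → Q (γ.curve (γ.time i.succ)))
    {j : Fin (γ.n + 1)} (hj : Q (γ.curve (γ.time j))) (i : Fin (γ.n + 1)) :
    Q (γ.curve (γ.time i)) := by
  have hlast : ∀ j : Fin (γ.n + 1), Q (γ.curve (γ.time j)) →
      Q (γ.curve (γ.time (Fin.last γ.n))) := by
    intro j
    induction j using Fin.reverseInduction with
    | last => exact id
    | cast i ih => exact fun hi => ih (hQ i hi)
  induction i using Fin.induction with
  | zero => rw [γ.closed]; exact hlast j hj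
  | succ i ih => exact hQ i ih

/-- A strongly repelling focus of `Z⁻` excludes sliding and escaping cycles. -/
theorem PLField.IsRepelling.no_cycle {Z : PLField} {g : ℝ} (h : Z.IsRepelling g)
    (γ : ClosedTrajectory Z) : ¬ γ.IsSlidingCycle ∧ ¬ γ.IsEscapingCycle := by
  suffices H : ∀ i, (γ.kind i = .sliding ∨ γ.kind i = .escaping) →
      ¬ (γ.Uses .plus ∨ γ.Uses .minus) from
    ⟨fun hs => hs.1.elim fun i hi => H i (Or.inl hi) hs.2,
      fun hs => hs.1.elim fun i hi => H i (Or.inr hi) hs.2⟩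
  intro i hi
  have hseg : γ.curve (γ.time i.castSucc) ∈ Z.foldSegment :=
    h.pair.mem_foldSegment (γ.isArc i) hi _ ⟨le_rfl, (γ.isArc i).lt.le⟩
  have hno : ∀ j, ¬ Z.Trap g (γ.curve (γ.time j)) := fun j hj =>
    not_mem_foldSegment_of_trap (γ.forall_of_exists (Q := Z.Trap g)
      (fun i hi => h.trap_step (γ.isArc i) hi) hj i.castSucc) hseg
  have hstep := fun (i : Fin γ.n) (hi : γ.curve (γ.time i.castSucc) ∈ Z.foldSegment) =>
    (h.segment_step (γ.isArc i) hi).resolve_right (hno _)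
  have hall := γ.forall_of_exists (Q := (· ∈ Z.foldSegment)) (fun i hi => (hstep i hi).2) hseg
  rintro (⟨j, hj⟩ | ⟨j, hj⟩)
  · simpa [hj] using (hstep j (hall _)).1
  · simpa [hj] using (hstep j (hall _)).1

/-! ### Construction of sliding cycles -/

/-- A solution of `Y' = G Y` with `G > 0` runs from `p` to `q` in finite time. -/
theorem exists_increasing_solution {G : ℝ → ℝ} {p q : ℝ} (hpq : p < q)
    (hG : ContinuousOn G (Icc p q)) (hpos : ∀ y ∈ Icc p q, 0 < G y) :
    ∃ (L : ℝ) (Y : ℝ → ℝ), 0 < L ∧ Continuous Y ∧ StrictMono Y ∧ Y 0 = p ∧ Y L = q ∧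
      ∀ t ∈ Icc 0 L, HasDerivAt Y (G (Y t)) t := by
  -- `Y` is the inverse of the time function `T y = ∫ 1 / G`, with `G` extended by constants
  set H : ℝ → ℝ := IccExtend hpq.le ((Icc p q).domRestrict G) with hH
  have hHc : Continuous H := (continuousOn_iff_continuous_domRestrict.1 hG).Icc_extend'
  have hHeq : ∀ y ∈ Icc p q, H y = G y := fun y hy => by
    rw [hH, IccExtend_of_mem hpq.le _ hy]; rfl
  have hHpos : ∀ y, 0 < H y := fun y => hpos _ (projIcc p q hpq.le y).2
  obtain ⟨B, hB⟩ := (isCompact_Icc.image_of_continuousOn hG).bddAbove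
  have hHB : ∀ y, H y ≤ B := fun y => hB ⟨_, (projIcc p q hpq.le y).2, rfl⟩
  have hB0 : 0 < B := (hHpos p).trans_le (hHB p)
  have hic : Continuous fun y => (H y)⁻¹ := hHc.inv₀ fun y => (hHpos y).ne'
  set T : ℝ → ℝ := fun y => ∫ z in p..y, (H z)⁻¹ with hT
  have hTd : ∀ y, HasDerivAt T (H y)⁻¹ y := fun y =>
    intervalIntegral.integral_hasDerivAt_right (hic.intervalIntegrable _ _)
      (hic.stronglyMeasurableAtFilter _ _) hic.continuousAt
  have hTp : T p = 0 := intervalIntegral.integral_same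
  have hTm : StrictMono T := strictMono_of_deriv_pos fun y => by
    rw [(hTd y).deriv]; exact inv_pos.2 (hHpos y)
  have hTc : Continuous T := continuous_iff_continuousAt.2 fun y => (hTd y).continuousAt
  have hmono : Monotone fun y => T y - B⁻¹ * y := by
    have hd : ∀ y, HasDerivAt (fun y => T y - B⁻¹ * y) ((H y)⁻¹ - B⁻¹) y := fun y =>
      ((hTd y).sub ((hasDerivAt_id y).const_mul B⁻¹)).congr_deriv (by simp)
    refine monotone_of_deriv_nonneg (fun y => (hd y).differentiableAt) fun y => ?_
    rw [(hd y).deriv]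
    exact sub_nonneg.2 (inv_anti₀ (hHpos y) (hHB y))
  have hsurj : Function.Surjective T := by
    refine hTc.surjective ?_ ?_
    · refine tendsto_atTop_mono' atTop ?_
        (tendsto_atTop_add_const_right _ (-(B⁻¹ * p))
          (tendsto_id.const_mul_atTop (inv_pos.2 hB0)))
      filter_upwards [eventually_ge_atTop p] with y hy
      have := hmono hy
      simp only [hTp, id] at this ⊢
      linarith
    · refine tendsto_atBot_mono' atBot ?_
        (tendsto_atBot_add_const_right _ (-(B⁻¹ * p))
          (tendsto_id.const_mul_atBot (inv_pos.2 hB0)))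
      filter_upwards [eventually_le_atBot p] with y hy
      have := hmono hy
      simp only [hTp, id] at this ⊢
      linarith
  set e := hTm.orderIsoOfSurjective T hsurj with he
  have heT : ∀ y, e y = T y := fun y => rfl
  have hsymm : ∀ y, e.symm (T y) = y := fun y => by rw [← heT, e.symm_apply_apply]
  have hTsymm : ∀ t, T (e.symm t) = t := fun t => by rw [← heT, e.apply_symm_apply]
  have h0 : e.symm 0 = p := by rw [← hTp, hsymm]
  refine ⟨T q, e.symm, ?_, e.symm.continuous, e.symm.strictMono, h0, hsymm q, fun t ht => ?_⟩
  · rw [← hTp]; exact hTm hpq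
  · have h1 := HasDerivAt.of_local_left_inverse e.symm.continuous.continuousAt
      (hTd (e.symm t)) (inv_pos.2 (hHpos _)).ne' (Eventually.of_forall hTsymm)
    rw [inv_inv] at h1
    refine h1.congr_deriv (hHeq _ ⟨?_, ?_⟩)
    · rw [← h0]; exact e.symm.monotone ht.1
    · rw [← hsymm q]; exact e.symm.monotone ht.2

namespace PLField

variable {Z : PLField}

/-- If both fields point upwards along the sliding region, the sliding vector field runs upwards
from each of its points to the fold of `Z⁻`. -/
theorem IsFocusPair.exists_sliding_arc (h : Z.IsFocusPair)
    (hup : ∀ y ∈ Icc Z.foldPlus Z.foldMinus, 0 < Z.plus ![0, y] 1 ∧ 0 < Z.minus ![0, y] 1)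
    {p q : ℝ} (hp : Z.foldPlus < p) (hpq : p < q) (hq : q ≤ Z.foldMinus) :
    ∃ X L, IsArc Z .sliding X 0 L ∧ X 0 = ![0, p] ∧ X L = ![0, q] ∧ InjOn X (Ico 0 L) ∧
      ∀ t ∈ Ico 0 L, X t 0 = 0 ∧ p ≤ X t 1 ∧ X t 1 < q := by
  have hcp := h.plus.coupling
  have hcm := h.minus.coupling
  set G : ℝ → ℝ := fun y => Z.slide ![0, y] 1 with hG
  have hm : ∀ y, Z.minus ![0, y] 0 = Z.Mm 0 1 * (y - Z.foldMinus) := fun y =>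
    h.minus_normal rfl
  have hpl : ∀ y, Z.plus ![0, y] 0 = Z.Mp 0 1 * (y - Z.foldPlus) := fun y =>
    h.plus_normal rfl
  have hm1 : ∀ y, Z.minus ![0, y] 1 = Z.Mm 1 1 * y + Z.um 1 := fun y => by
    rw [PLField.minus, affine_apply_one]; simp
  have hp1 : ∀ y, Z.plus ![0, y] 1 = Z.Mp 1 1 * y + Z.up 1 := fun y => by
    rw [PLField.plus, affine_apply_one]; simp
  have hGeq : ∀ y, G y = (Z.minus ![0, y] 0 - Z.plus ![0, y] 0)⁻¹ *
      (Z.minus ![0, y] 0 * Z.plus ![0, y] 1 - Z.plus ![0, y] 0 * Z.minus ![0, y] 1) := fun y => by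
    simp [hG, slide]
  have hsgn : ∀ y ∈ Icc p q, 0 ≤ Z.minus ![0, y] 0 ∧ Z.plus ![0, y] 0 < 0 := by
    intro y hy
    rw [hm, hpl]
    exact ⟨mul_nonneg_of_nonpos_of_nonpos hcm.le (by linarith [hy.2]),
      mul_neg_of_neg_of_pos hcp (by linarith [hy.1])⟩
  have hden : ∀ y ∈ Icc p q, 0 < Z.minus ![0, y] 0 - Z.plus ![0, y] 0 := fun y hy => by
    linarith [hsgn y hy]
  have hGpos : ∀ y ∈ Icc p q, 0 < G y := by
    intro y hy
    obtain ⟨h1, h2⟩ := hsgn y hy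
    obtain ⟨h3, h4⟩ := hup y ⟨hp.le.trans hy.1, hy.2.trans hq⟩
    rw [hGeq]
    refine mul_pos (inv_pos.2 (hden y hy)) ?_
    nlinarith [mul_nonneg h1 h3.le, mul_neg_of_neg_of_pos h2 h4]
  have hGc : ContinuousOn G (Icc p q) := by
    have hc1 : ContinuousOn (fun y => (Z.minus ![0, y] 0 - Z.plus ![0, y] 0)⁻¹) (Icc p q) := by
      refine ContinuousOn.inv₀ ?_ fun y hy => (hden y hy).ne'
      simp only [hm, hpl]
      fun_prop
    refine ContinuousOn.congr (hc1.mul ?_) fun y _ => hGeq y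
    simp only [hm, hpl, hm1, hp1]
    fun_prop
  obtain ⟨L, Y, hL, hYc, hYm, hY0, hYL, hYd⟩ := exists_increasing_solution hpq hGc hGpos
  have hslide0 : ∀ y, Z.slide ![0, y] 0 = 0 := fun y => by
    simp only [slide, Pi.smul_apply, Pi.sub_apply, smul_eq_mul]
    ring
  refine ⟨fun t => ![0, Y t], L, ⟨hL, ?_, fun t ht => ?_, fun t ht => ?_⟩, by simp [hY0],
    by simp [hYL], ?_, fun t ht => ?_⟩
  · refine (continuous_pi fun i => ?_).continuousOn
    fin_cases i
    · exact continuous_const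
    · exact hYc
  · refine h.mem_slidingRegion.2 ⟨rfl, ?_, ?_⟩
    · have := hYm ht.1
      rw [hY0] at this
      exact hp.trans this
    · have := hYm ht.2
      rw [hYL] at this
      exact this.trans_le hq
  · rw [hasDerivAt_pi]
    intro i
    fin_cases i
    · exact (hasDerivAt_const t (0 : ℝ)).congr_deriv (hslide0 _).symm
    · exact hYd t ⟨ht.1.le, ht.2.le⟩
  · intro s _ t _ hst
    exact hYm.injective (by simpa using congrFun hst 1)
  · refine ⟨rfl, ?_, ?_⟩
    · rw [← hY0]; exact hYm.monotone ht.1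
    · rw [← hYL]; exact hYm ht.2

/-- The orbit of `Z⁻` that starts at its visible fold goes round the focus and comes back to the
switching line below the fold. -/
theorem IsFocusPair.exists_minus_arc (h : Z.IsFocusPair) {s : ℝ} (hs : s ∈ Ioo 0 Real.pi)
    (hroot : Real.exp (focusRate Z.Mm / focusFreq Z.Mm * (2 * Real.pi - s)) *
      (Real.cos s + focusRate Z.Mm / focusFreq Z.Mm * Real.sin s) = 1) :
    ∃ X L y, IsArc Z .minus X 0 L ∧ X 0 = ![0, Z.foldMinus] ∧ X L = ![0, y] ∧
      InjOn X (Ico 0 L) ∧ (∀ t ∈ Ico 0 L, X t 0 < 0 ∨ X t = ![0, Z.foldMinus]) ∧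
      Z.Mm 0 1 * (y - Z.foldMinus) = -foldAccel Z.Mm Z.um / focusFreq Z.Mm *
        (Real.exp (focusRate Z.Mm / focusFreq Z.Mm * (2 * Real.pi - s)) * Real.sin s) := by
  have hω := h.minus.freq_pos
  obtain ⟨X, hX, hX0⟩ := h.minus.exists_flow ![0, Z.foldMinus]
  have h0 : X 0 0 = 0 := by rw [hX0]; rfl
  have hv0 : (Z.Mm *ᵥ X 0 + Z.um) 0 = 0 := by
    rw [h.minus.normal_velocity h0, hX0]; simp [foldMinus]
  obtain ⟨hneg, hxL, hvL, hinj⟩ :=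
    (hX.oscillator h.minus).return_of_rest hω h.minus.accel h0 hv0 hs hroot
  set L := (2 * Real.pi - s) / focusFreq Z.Mm
  have hL : 0 < L := div_pos (by linarith [hs.2, Real.pi_pos]) hω
  refine ⟨X, L, X L 1, ⟨hL, ?_, hneg, fun t _ => hX t⟩, hX0, ?_, ?_, fun t ht => ?_, ?_⟩
  · exact (continuous_iff_continuousAt.2 fun t => (hX t).continuousAt).continuousOn
  · ext i
    fin_cases i
    · exact hxL
    · rfl
  · intro t ht t' ht' heq
    refine hinj ht ht' ?_
    simp only [heq]
  · rcases ht.1.eq_or_lt with rfl | ht0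
    · exact Or.inr hX0
    · exact Or.inl (hneg t ⟨ht0, ht.2⟩)
  · rw [← hvL, h.minus.normal_velocity hxL]; rfl

/-- The orbit of `Z⁺` that starts below its invisible fold makes an excursion to the right, and
ends above the fold; it is nearly a reflection if the trace of `Z⁺` is small. -/
theorem IsFocusPair.exists_plus_arc (h : Z.IsFocusPair) {y : ℝ} (hy : y < Z.foldPlus) :
    ∃ X L z, IsArc Z .plus X 0 L ∧ X 0 = ![0, y] ∧ X L = ![0, z] ∧
      InjOn X (Ico 0 L) ∧ (∀ t ∈ Ico 0 L, 0 < X t 0 ∨ X t = ![0, y]) ∧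
      Z.foldPlus < z ∧ z - Z.foldPlus ≤ (Z.foldPlus - y) *
        Real.exp (2 * |focusRate Z.Mp| * (Real.pi / focusFreq Z.Mp)) := by
  have hω := h.plus.freq_pos
  have hc := h.plus.coupling
  obtain ⟨X, hX, hX0⟩ := h.plus.exists_flow ![0, y]
  have h0 : X 0 0 = 0 := by rw [hX0]; rfl
  have hveq : (Z.Mp *ᵥ X 0 + Z.up) 0 = Z.Mp 0 1 * (y - Z.foldPlus) := by
    rw [h.plus.normal_velocity h0, hX0]; rfl
  have hv0 : 0 < (Z.Mp *ᵥ X 0 + Z.up) 0 := by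
    rw [hveq]; exact mul_pos_of_neg_of_neg hc (by linarith)
  have ho := hX.oscillator h.plus
  obtain ⟨L, hL, hpos, hxL, hinj⟩ := ho.exists_return_of_pos hω h.plus.accel h0 hv0
  obtain ⟨h1, h2⟩ := ho.landing_of_pos hω h.plus.accel h0 hv0 hL hpos hxL
  have hvL : (Z.Mp *ᵥ X L + Z.up) 0 = Z.Mp 0 1 * (X L 1 - Z.foldPlus) :=
    h.plus.normal_velocity hxL
  have h3 := h1.trans_lt' (mul_pos hv0 (Real.exp_pos _))
  rw [hvL] at h2 h3
  rw [hveq] at h2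
  refine ⟨X, L, X L 1, ⟨hL, ?_, hpos, fun t _ => hX t⟩, hX0, ?_, ?_, fun t ht => ?_, ?_, ?_⟩
  · exact (continuous_iff_continuousAt.2 fun t => (hX t).continuousAt).continuousOn
  · ext i
    fin_cases i
    · exact hxL
    · rfl
  · intro t ht t' ht' heq
    refine hinj ht ht' ?_
    simp only [heq]
  · rcases ht.1.eq_or_lt with rfl | ht0
    · exact Or.inr hX0
    · exact Or.inl (hpos t ⟨ht0, ht.2⟩)
  · nlinarith
  · by_contra hlt
    push Not at hlt
    have := mul_lt_mul_of_neg_left hlt hc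
    nlinarith

end PLField

/-- Three arcs that fit together and do not meet form a simple closed trajectory. -/
theorem ClosedTrajectory.exists_of_three_arcs {Z : PLField} {k₁ k₂ k₃ : ArcKind}
    {X₁ X₂ X₃ : ℝ → Fin 2 → ℝ} {L₁ L₂ L₃ : ℝ}
    (h₁ : IsArc Z k₁ X₁ 0 L₁) (h₂ : IsArc Z k₂ X₂ 0 L₂) (h₃ : IsArc Z k₃ X₃ 0 L₃)
    (j₁ : X₁ L₁ = X₂ 0) (j₂ : X₂ L₂ = X₃ 0) (j₃ : X₃ L₃ = X₁ 0)
    (i₁ : InjOn X₁ (Ico 0 L₁)) (i₂ : InjOn X₂ (Ico 0 L₂)) (i₃ : InjOn X₃ (Ico 0 L₃))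
    (d₁₂ : ∀ s ∈ Ico 0 L₁, ∀ t ∈ Ico 0 L₂, X₁ s ≠ X₂ t)
    (d₁₃ : ∀ s ∈ Ico 0 L₁, ∀ t ∈ Ico 0 L₃, X₁ s ≠ X₃ t)
    (d₂₃ : ∀ s ∈ Ico 0 L₂, ∀ t ∈ Ico 0 L₃, X₂ s ≠ X₃ t) :
    ∃ γ : ClosedTrajectory Z, γ.IsSimple ∧ ∀ k, γ.Uses k ↔ k = k₁ ∨ k = k₂ ∨ k = k₃ := by
  have l₁ := h₁.lt
  have l₂ := h₂.lt
  have l₃ := h₃.lt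
  set c : ℝ → Fin 2 → ℝ := fun t => if t < L₁ then X₁ t else
    if t < L₁ + L₂ then X₂ (t - L₁) else X₃ (t - (L₁ + L₂)) with hc
  have c₁ : ∀ t, t < L₁ → c t = X₁ t := fun t ht => by simp [hc, ht]
  have c₂ : ∀ t, L₁ ≤ t → t < L₁ + L₂ → c t = X₂ (t - L₁) := fun t ht ht' => by
    simp [hc, ht.not_gt, ht']
  have c₃ : ∀ t, L₁ + L₂ ≤ t → c t = X₃ (t - (L₁ + L₂)) := fun t ht => by
    have : ¬ t < L₁ := by linarith
    simp [hc, this, ht.not_gt]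
  have c₁' : ∀ t ∈ Icc 0 L₁, c t = X₁ t := by
    intro t ht
    rcases ht.2.eq_or_lt with rfl | h
    · rw [c₂ _ le_rfl (by linarith), sub_self, j₁]
    · exact c₁ t h
  have c₂' : ∀ t ∈ Icc L₁ (L₁ + L₂), c t = X₂ (t - L₁) := by
    intro t ht
    rcases ht.2.eq_or_lt with rfl | h
    · rw [c₃ _ le_rfl, sub_self, ← j₂]; congr 1; ring
    · exact c₂ t ht.1 h
  have hcont : ContinuousOn c (Icc 0 (L₁ + L₂ + L₃)) := by
    have k₁ : ContinuousOn c (Icc 0 L₁) := h₁.continuousOn.congr c₁'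
    have k₂ : ContinuousOn c (Icc L₁ (L₁ + L₂)) := by
      refine ContinuousOn.congr (h₂.continuousOn.comp (by fun_prop) fun t ht => ?_) c₂'
      exact ⟨by linarith [ht.1], by linarith [ht.2]⟩
    have k₃ : ContinuousOn c (Icc (L₁ + L₂) (L₁ + L₂ + L₃)) := by
      refine ContinuousOn.congr (h₃.continuousOn.comp (f := fun t => t - (L₁ + L₂))
        (by fun_prop) fun t ht => ?_) fun t ht => c₃ t ht.1
      exact ⟨by linarith [ht.1], by linarith [ht.2]⟩
    have k₁₂ := k₁.union_of_isClosed k₂ isClosed_Icc isClosed_Icc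
    rw [Icc_union_Icc_eq_Icc l₁.le (by linarith)] at k₁₂
    have k₁₃ := k₁₂.union_of_isClosed k₃ isClosed_Icc isClosed_Icc
    rwa [Icc_union_Icc_eq_Icc (by linarith) (by linarith)] at k₁₃
  have hshift : ∀ {X : ℝ → Fin 2 → ℝ} {X' : Fin 2 → ℝ} {a t : ℝ}, HasDerivAt X X' (t - a) →
      HasDerivAt (fun t => X (t - a)) X' t := fun {X X' a t} h =>
    (h.scomp t ((hasDerivAt_id t).sub_const a)).congr_deriv (one_smul _ _)
  refine ⟨{
    n := 3
    n_pos := by norm_num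
    time := ![0, L₁, L₁ + L₂, L₁ + L₂ + L₃]
    time_strictMono := by
      refine Fin.strictMono_iff_lt_succ.2 fun i => ?_
      fin_cases i
      · exact l₁
      · change L₁ < L₁ + L₂
        linarith
      · change L₁ + L₂ < L₁ + L₂ + L₃
        linarith
    kind := ![k₁, k₂, k₃]
    curve := c
    continuousOn := hcont
    closed := by
      change c 0 = c (L₁ + L₂ + L₃)
      rw [c₁ 0 l₁, c₃ _ (by linarith), ← j₃]
      congr 1
      ring
    mem_region := fun i t ht => by
      fin_cases i
      · change t ∈ Ioo 0 L₁ at ht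
        rw [c₁ t ht.2]
        exact h₁.mem_region t ht
      · change t ∈ Ioo L₁ (L₁ + L₂) at ht
        rw [c₂ t ht.1.le ht.2]
        exact h₂.mem_region _ ⟨by linarith [ht.1], by linarith [ht.2]⟩
      · change t ∈ Ioo (L₁ + L₂) (L₁ + L₂ + L₃) at ht
        rw [c₃ t ht.1.le]
        exact h₃.mem_region _ ⟨by linarith [ht.1], by linarith [ht.2]⟩
    hasDerivAt := fun i t ht => by
      fin_cases i
      · change t ∈ Ioo 0 L₁ at ht
        rw [c₁ t ht.2]
        refine (h₁.hasDerivAt t ht).congr_of_eventuallyEq ?_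
        filter_upwards [isOpen_Ioo.mem_nhds ht] with r hr using c₁ r hr.2
      · change t ∈ Ioo L₁ (L₁ + L₂) at ht
        rw [c₂ t ht.1.le ht.2]
        refine (hshift (h₂.hasDerivAt (t - L₁)
          ⟨by linarith [ht.1], by linarith [ht.2]⟩)).congr_of_eventuallyEq ?_
        filter_upwards [isOpen_Ioo.mem_nhds ht] with r hr using c₂ r hr.1.le hr.2
      · change t ∈ Ioo (L₁ + L₂) (L₁ + L₂ + L₃) at ht
        rw [c₃ t ht.1.le]
        refine (hshift (h₃.hasDerivAt (t - (L₁ + L₂))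
          ⟨by linarith [ht.1], by linarith [ht.2]⟩)).congr_of_eventuallyEq ?_
        filter_upwards [isOpen_Ioo.mem_nhds ht] with r hr using c₃ r hr.1.le }, ?_, fun k => ?_⟩
  · change InjOn c (Ico 0 (L₁ + L₂ + L₃))
    intro s hs t ht heq
    have m₁ : ∀ r ∈ Ico 0 (L₁ + L₂ + L₃), r < L₁ → r ∈ Ico 0 L₁ := fun r hr h => ⟨hr.1, h⟩
    have m₂ : ∀ r, L₁ ≤ r → r < L₁ + L₂ → r - L₁ ∈ Ico 0 L₂ := fun r h h' =>
      ⟨by linarith, by linarith⟩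
    have m₃ : ∀ r ∈ Ico 0 (L₁ + L₂ + L₃), L₁ + L₂ ≤ r → r - (L₁ + L₂) ∈ Ico 0 L₃ := fun r hr h =>
      ⟨by linarith, by linarith [hr.2]⟩
    rcases lt_or_ge s L₁ with s₁ | s₁
    · rw [c₁ s s₁] at heq
      rcases lt_or_ge t L₁ with t₁ | t₁
      · rw [c₁ t t₁] at heq
        exact i₁ (m₁ s hs s₁) (m₁ t ht t₁) heq
      rcases lt_or_ge t (L₁ + L₂) with t₂ | t₂
      · rw [c₂ t t₁ t₂] at heq
        exact absurd heq (d₁₂ _ (m₁ s hs s₁) _ (m₂ t t₁ t₂))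
      · rw [c₃ t t₂] at heq
        exact absurd heq (d₁₃ _ (m₁ s hs s₁) _ (m₃ t ht t₂))
    rcases lt_or_ge s (L₁ + L₂) with s₂ | s₂
    · rw [c₂ s s₁ s₂] at heq
      rcases lt_or_ge t L₁ with t₁ | t₁
      · rw [c₁ t t₁] at heq
        exact absurd heq.symm (d₁₂ _ (m₁ t ht t₁) _ (m₂ s s₁ s₂))
      rcases lt_or_ge t (L₁ + L₂) with t₂ | t₂
      · rw [c₂ t t₁ t₂] at heq
        linarith [i₂ (m₂ s s₁ s₂) (m₂ t t₁ t₂) heq]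
      · rw [c₃ t t₂] at heq
        exact absurd heq (d₂₃ _ (m₂ s s₁ s₂) _ (m₃ t ht t₂))
    · rw [c₃ s s₂] at heq
      rcases lt_or_ge t L₁ with t₁ | t₁
      · rw [c₁ t t₁] at heq
        exact absurd heq.symm (d₁₃ _ (m₁ t ht t₁) _ (m₃ s hs s₂))
      rcases lt_or_ge t (L₁ + L₂) with t₂ | t₂
      · rw [c₂ t t₁ t₂] at heq
        exact absurd heq.symm (d₂₃ _ (m₂ t t₁ t₂) _ (m₃ s hs s₂))
      · rw [c₃ t t₂] at heq
        linarith [i₃ (m₃ s hs s₂) (m₃ t ht t₂) heq]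
  · change (∃ i : Fin 3, ![k₁, k₂, k₃] i = k) ↔ _
    rw [Fin.exists_fin_succ, Fin.exists_fin_succ, Fin.exists_fin_succ]
    simp [eq_comm]

namespace PLField

variable {Z : PLField}

/-- The speed with which the orbit of `Z⁻` through its fold crosses the switching line after having
turned by the angle `2 π - s`. -/
noncomputable def foldReturnSpeed (Z : PLField) (s : ℝ) : ℝ :=
  -foldAccel Z.Mm Z.um / focusFreq Z.Mm *
    (Real.exp (focusRate Z.Mm / focusFreq Z.Mm * (2 * Real.pi - s)) * Real.sin s)

/-- The data common to the sliding cycles of both types: the sliding region is not empty, both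
fields point upwards along it, and `2 π - s` is the return angle of the orbit through the fold of
`Z⁻`. -/
structure IsSlidingPair (Z : PLField) (s : ℝ) : Prop where
  pair : Z.IsFocusPair
  lt : Z.foldPlus < Z.foldMinus
  up : ∀ y ∈ Icc Z.foldPlus Z.foldMinus, 0 < Z.plus ![0, y] 1 ∧ 0 < Z.minus ![0, y] 1
  angle : s ∈ Ioo 0 Real.pi
  root : Real.exp (focusRate Z.Mm / focusFreq Z.Mm * (2 * Real.pi - s)) *
      (Real.cos s + focusRate Z.Mm / focusFreq Z.Mm * Real.sin s) = 1

theorem IsSlidingPair.speed_pos {s : ℝ} (h : Z.IsSlidingPair s) : 0 < Z.foldReturnSpeed s :=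
  mul_pos (div_pos (neg_pos.2 h.pair.minus.accel) h.pair.minus.freq_pos)
    (mul_pos (Real.exp_pos _) (Real.sin_pos_of_pos_of_lt_pi h.angle.1 h.angle.2))

/-- If the orbit through the fold of `Z⁻` returns into the sliding region, it closes up by
sliding. -/
theorem IsSlidingPair.exists_typeI {s : ℝ} (h : Z.IsSlidingPair s)
    (hs : Z.foldReturnSpeed s < -Z.Mm 0 1 * (Z.foldMinus - Z.foldPlus)) :
    ∃ γ : ClosedTrajectory Z, γ.IsProperSlidingCycle ∧ γ.IsTypeI := by
  have hc := h.pair.minus.coupling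
  obtain ⟨X₁, L₁, y, a₁, s₁, e₁, i₁, r₁, hy⟩ := h.pair.exists_minus_arc h.angle h.root
  change _ = Z.foldReturnSpeed s at hy
  have hw := h.speed_pos
  rw [← hy] at hs hw
  have hy1 : y < Z.foldMinus := by nlinarith
  have hy2 : Z.foldPlus < y := by nlinarith
  -- the sliding arc is cut into two
  obtain ⟨X₂, L₂, a₂, s₂, e₂, i₂, r₂⟩ := h.pair.exists_sliding_arc h.up (p := y)
    (q := (y + Z.foldMinus) / 2) hy2 (by linarith) (by linarith)
  obtain ⟨X₃, L₃, a₃, s₃, e₃, i₃, r₃⟩ := h.pair.exists_sliding_arc h.up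
    (p := (y + Z.foldMinus) / 2) (q := Z.foldMinus) (by linarith) (by linarith) le_rfl
  have hd : ∀ p : Fin 2 → ℝ, (p 0 < 0 ∨ p = ![0, Z.foldMinus]) → ∀ q : Fin 2 → ℝ, q 0 = 0 →
      q 1 < Z.foldMinus → p ≠ q := by
    rintro p hp q hq0 hq1 rfl
    rcases hp with hp | rfl
    · linarith
    · exact lt_irrefl _ hq1
  obtain ⟨γ, hγ, hu⟩ := ClosedTrajectory.exists_of_three_arcs a₁ a₂ a₃ (e₁.trans s₂.symm)
    (e₂.trans s₃.symm) (e₃.trans s₁.symm) i₁ i₂ i₃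
    (fun t ht r hr => hd _ (r₁ t ht) _ (r₂ r hr).1 (by linarith [(r₂ r hr).2.2]))
    (fun t ht r hr => hd _ (r₁ t ht) _ (r₃ r hr).1 (r₃ r hr).2.2)
    (fun t ht r hr heq => by
      have := (r₂ t ht).2.2
      rw [heq] at this
      linarith [(r₃ r hr).2.1])
  refine ⟨γ, ⟨hγ, ⟨?_, Or.inr ?_⟩, ?_⟩, Or.inr ⟨?_, ?_⟩⟩ <;> simp [hu]

/-- If the orbit through the fold of `Z⁻` returns below the fold of `Z⁺`, but not too far from it,
an excursion of `Z⁺` takes it into the sliding region, where it closes up by sliding. -/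
theorem IsSlidingPair.exists_typeII {s : ℝ} (h : Z.IsSlidingPair s)
    (hs : -Z.Mm 0 1 * (Z.foldMinus - Z.foldPlus) < Z.foldReturnSpeed s)
    (hs' : Z.foldReturnSpeed s < -Z.Mm 0 1 * (Z.foldMinus - Z.foldPlus) *
      (1 + Real.exp (-(2 * |focusRate Z.Mp| * (Real.pi / focusFreq Z.Mp))))) :
    ∃ γ : ClosedTrajectory Z, γ.IsProperSlidingCycle ∧ γ.IsTypeII := by
  have hc := h.pair.minus.coupling
  obtain ⟨X₁, L₁, y, a₁, s₁, e₁, i₁, r₁, hy⟩ := h.pair.exists_minus_arc h.angle h.root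
  change _ = Z.foldReturnSpeed s at hy
  rw [← hy] at hs hs'
  have hlt := h.lt
  have hy2 : y < Z.foldPlus := by nlinarith
  obtain ⟨X₂, L₂, z, a₂, s₂, e₂, i₂, r₂, hz, hz'⟩ := h.pair.exists_plus_arc hy2
  have hzm : z < Z.foldMinus := by
    rw [Real.exp_neg] at hs'
    set q := Real.exp (2 * |focusRate Z.Mp| * (Real.pi / focusFreq Z.Mp))
    have hq : 0 < q := Real.exp_pos _
    have h1 : Z.foldMinus - y < (Z.foldMinus - Z.foldPlus) * (1 + q⁻¹) := by nlinarith
    have h2 : Z.foldPlus - y < (Z.foldMinus - Z.foldPlus) * q⁻¹ := by linarith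
    have h3 := mul_lt_mul_of_pos_right h2 hq
    rw [inv_mul_cancel_right₀ hq.ne'] at h3
    linarith
  obtain ⟨X₃, L₃, a₃, s₃, e₃, i₃, r₃⟩ := h.pair.exists_sliding_arc h.up hz hzm le_rfl
  obtain ⟨γ, hγ, hu⟩ := ClosedTrajectory.exists_of_three_arcs a₁ a₂ a₃ (e₁.trans s₂.symm)
    (e₂.trans s₃.symm) (e₃.trans s₁.symm) i₁ i₂ i₃
    (fun t ht r hr heq => by
      rcases r₁ t ht with h1 | h1 <;> rcases r₂ r hr with h2 | h2
      · rw [heq] at h1; linarith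
      · rw [heq, h2] at h1; simp at h1
      · rw [← heq, h1] at h2; simp at h2
      · rw [h1, h2] at heq
        have := congrFun heq 1
        simp at this
        linarith)
    (fun t ht r hr heq => by
      rcases r₁ t ht with h1 | h1
      · rw [heq, (r₃ r hr).1] at h1; exact lt_irrefl _ h1
      · rw [h1] at heq
        have := congrFun heq 1
        simp at this
        linarith [(r₃ r hr).2.2])
    (fun t ht r hr heq => by
      rcases r₂ t ht with h1 | h1
      · rw [heq, (r₃ r hr).1] at h1; exact lt_irrefl _ h1
      · rw [h1] at heq
        have := congrFun heq 1
        simp at this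
        linarith [(r₃ r hr).2.1])
  refine ⟨γ, ⟨hγ, ⟨?_, Or.inr ?_⟩, ?_⟩, ?_, ?_⟩ <;> simp [hu]

end PLField

/-! ### Asymptotics of the perturbed center -/

theorem tendsto_self_nhdsGT : Tendsto (fun ε : ℝ => ε) (𝓝[>] 0) (𝓝 0) :=
  tendsto_nhdsWithin_of_tendsto_nhds tendsto_id

section Expansion

variable {f : ℝ → ℝ} {A B C : ℝ}

theorem tendsto_second_order
    (h : (fun ε : ℝ => f ε - (A + ε * B + ε ^ 2 * C)) =O[𝓝[>] 0] (fun ε : ℝ => ε ^ 3)) :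
    Tendsto (fun ε => (f ε - A - ε * B) / ε ^ 2) (𝓝[>] 0) (𝓝 C) := by
  have h1 : (fun ε : ℝ => ε ^ 3) =o[𝓝[>] 0] (fun ε : ℝ => ε ^ 2) :=
    (isLittleO_pow_pow (by norm_num)).mono nhdsWithin_le_nhds
  have h2 := ((h.trans_isLittleO h1).tendsto_div_nhds_zero).add_const C
  rw [zero_add] at h2
  refine h2.congr' ?_
  filter_upwards [self_mem_nhdsWithin] with ε (hε : 0 < ε)
  field_simp
  ring

theorem tendsto_first_order
    (h : (fun ε : ℝ => f ε - (A + ε * B + ε ^ 2 * C)) =O[𝓝[>] 0] (fun ε : ℝ => ε ^ 3)) :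
    Tendsto (fun ε => (f ε - A) / ε) (𝓝[>] 0) (𝓝 B) := by
  have h1 := ((tendsto_second_order h).mul tendsto_self_nhdsGT).add_const B
  rw [mul_zero, zero_add] at h1
  refine h1.congr' ?_
  filter_upwards [self_mem_nhdsWithin] with ε (hε : 0 < ε)
  field_simp
  ring

theorem tendsto_zeroth_order
    (h : (fun ε : ℝ => f ε - (A + ε * B + ε ^ 2 * C)) =O[𝓝[>] 0] (fun ε : ℝ => ε ^ 3)) :
    Tendsto f (𝓝[>] 0) (𝓝 A) := by
  have h1 := ((tendsto_first_order h).mul tendsto_self_nhdsGT).add_const A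
  rw [mul_zero, zero_add] at h1
  refine h1.congr' ?_
  filter_upwards [self_mem_nhdsWithin] with ε (hε : 0 < ε)
  field_simp
  ring

end Expansion

/-- Comparison of the leading terms of two positive quantities of order `ε`. -/
theorem eventually_lt_of_sq_div {f g : ℝ → ℝ} {A B : ℝ}
    (hf : Tendsto (fun ε => f ε ^ 2 / ε ^ 2) (𝓝[>] 0) (𝓝 A))
    (hg : Tendsto (fun ε => g ε ^ 2 / ε ^ 2) (𝓝[>] 0) (𝓝 B)) (hAB : A < B)
    (hpos : ∀ᶠ ε in 𝓝[>] (0 : ℝ), 0 ≤ g ε) : ∀ᶠ ε in 𝓝[>] (0 : ℝ), f ε < g ε := by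
  filter_upwards [self_mem_nhdsWithin, hf.eventually_lt hg hAB, hpos] with ε (hε : 0 < ε) h1 h2
  exact lt_of_pow_lt_pow_left₀ 2 h2 ((div_lt_div_iff_of_pos_right (by positivity)).1 h1)

theorem MatrixExpansion.reverse {M : ℝ → Matrix (Fin 2) (Fin 2) ℝ}
    {A B C : Matrix (Fin 2) (Fin 2) ℝ} (h : MatrixExpansion M A B C) :
    MatrixExpansion (fun ε => reverseMatrix (M ε)) (reverseMatrix A) (reverseMatrix B)
      (reverseMatrix C) := by
  intro i j
  have hn := (h i j).neg_left
  fin_cases i <;> fin_cases j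
  · refine hn.congr_left fun ε => ?_
    simp [reverseMatrix]
    ring
  · exact h 0 1
  · exact h 1 0
  · refine hn.congr_left fun ε => ?_
    simp [reverseMatrix]
    ring

theorem VectorExpansion.reverse {u : ℝ → Fin 2 → ℝ} {u₀ v w : Fin 2 → ℝ}
    (h : VectorExpansion u u₀ v w) :
    VectorExpansion (fun ε => reverseVector (u ε)) (reverseVector u₀) (reverseVector v)
      (reverseVector w) := by
  intro i
  have hn := (h i).neg_left
  fin_cases i
  · refine hn.congr_left fun ε => ?_
    simp [reverseVector]
    ring
  · exact h 1

/-- A second order perturbation of the canonical form of a piecewise linear global center that is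
real for `Z⁻` and virtual for `Z⁺`. -/
structure PerturbedCenter (a b c d e : ℝ) (Bp Bm Cp Cm : Matrix (Fin 2) (Fin 2) ℝ)
    (vp vm wp wm : Fin 2 → ℝ) (Z : ℝ → PLField) : Prop where
  b_neg : b < 0
  d_pos : 0 < d
  e_pos : 0 < e
  disc : a ^ 2 + b * c < 0
  Mp : MatrixExpansion (fun ε => (Z ε).Mp) !![a, b; c, -a] Bp Cp
  up : VectorExpansion (fun ε => (Z ε).up) ![0, d] vp wp
  Mm : MatrixExpansion (fun ε => (Z ε).Mm) !![0, -1; 1, 0] Bm Cm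
  um : VectorExpansion (fun ε => (Z ε).um) ![0, e] vm wm

namespace PerturbedCenter

variable {a b c d e : ℝ} {Bp Bm Cp Cm : Matrix (Fin 2) (Fin 2) ℝ} {vp vm wp wm : Fin 2 → ℝ}
  {Z : ℝ → PLField}

theorem reverse (h : PerturbedCenter a b c d e Bp Bm Cp Cm vp vm wp wm Z) :
    PerturbedCenter (-a) b c d e (reverseMatrix Bp) (reverseMatrix Bm) (reverseMatrix Cp)
      (reverseMatrix Cm) (reverseVector vp) (reverseVector vm) (reverseVector wp)
      (reverseVector wm) (fun ε => (Z ε).reverse) where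
  b_neg := h.b_neg
  d_pos := h.d_pos
  e_pos := h.e_pos
  disc := by rw [neg_sq]; exact h.disc
  Mp := by
    have := h.Mp.reverse
    simpa [PLField.reverse, reverseMatrix] using this
  up := by
    have := h.up.reverse
    simpa [PLField.reverse, reverseVector] using this
  Mm := by
    have := h.Mm.reverse
    simpa [PLField.reverse, reverseMatrix] using this
  um := by
    have := h.um.reverse
    simpa [PLField.reverse, reverseVector] using this

theorem tendsto_Mp (h : PerturbedCenter a b c d e Bp Bm Cp Cm vp vm wp wm Z) (i j : Fin 2) :
    Tendsto (fun ε => (Z ε).Mp i j) (𝓝[>] 0) (𝓝 (!![a, b; c, -a] i j)) :=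
  tendsto_zeroth_order (h.Mp i j)

theorem tendsto_Mm (h : PerturbedCenter a b c d e Bp Bm Cp Cm vp vm wp wm Z) (i j : Fin 2) :
    Tendsto (fun ε => (Z ε).Mm i j) (𝓝[>] 0) (𝓝 (!![0, -1; 1, 0] i j)) :=
  tendsto_zeroth_order (h.Mm i j)

theorem tendsto_up (h : PerturbedCenter a b c d e Bp Bm Cp Cm vp vm wp wm Z) (i : Fin 2) :
    Tendsto (fun ε => (Z ε).up i) (𝓝[>] 0) (𝓝 (![0, d] i)) :=
  tendsto_zeroth_order (h.up i)

theorem tendsto_um (h : PerturbedCenter a b c d e Bp Bm Cp Cm vp vm wp wm Z) (i : Fin 2) :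
    Tendsto (fun ε => (Z ε).um i) (𝓝[>] 0) (𝓝 (![0, e] i)) :=
  tendsto_zeroth_order (h.um i)

variable (h : PerturbedCenter a b c d e Bp Bm Cp Cm vp vm wp wm Z)
include h

theorem tendsto_rate_plus : Tendsto (fun ε => focusRate (Z ε).Mp) (𝓝[>] 0) (𝓝 0) := by
  have := ((h.tendsto_Mp 0 0).add (h.tendsto_Mp 1 1)).div_const 2
  simpa [focusRate] using this

theorem tendsto_rate_minus : Tendsto (fun ε => focusRate (Z ε).Mm) (𝓝[>] 0) (𝓝 0) := by
  have := ((h.tendsto_Mm 0 0).add (h.tendsto_Mm 1 1)).div_const 2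
  simpa [focusRate] using this

theorem tendsto_disc_plus : Tendsto (fun ε => (Z ε).Mp 0 0 * (Z ε).Mp 1 1 -
    (Z ε).Mp 0 1 * (Z ε).Mp 1 0 - focusRate (Z ε).Mp ^ 2) (𝓝[>] 0) (𝓝 (-(a ^ 2 + b * c))) := by
  have := (((h.tendsto_Mp 0 0).mul (h.tendsto_Mp 1 1)).sub
    ((h.tendsto_Mp 0 1).mul (h.tendsto_Mp 1 0))).sub (h.tendsto_rate_plus.pow 2)
  convert this using 2
  simp
  ring

theorem tendsto_disc_minus : Tendsto (fun ε => (Z ε).Mm 0 0 * (Z ε).Mm 1 1 -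
    (Z ε).Mm 0 1 * (Z ε).Mm 1 0 - focusRate (Z ε).Mm ^ 2) (𝓝[>] 0) (𝓝 1) := by
  have := (((h.tendsto_Mm 0 0).mul (h.tendsto_Mm 1 1)).sub
    ((h.tendsto_Mm 0 1).mul (h.tendsto_Mm 1 0))).sub (h.tendsto_rate_minus.pow 2)
  convert this using 2
  simp

theorem tendsto_freq_plus : Tendsto (fun ε => focusFreq (Z ε).Mp) (𝓝[>] 0)
    (𝓝 (√(-(a ^ 2 + b * c)))) := h.tendsto_disc_plus.sqrt

theorem tendsto_freq_minus : Tendsto (fun ε => focusFreq (Z ε).Mm) (𝓝[>] 0) (𝓝 1) := by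
  have := h.tendsto_disc_minus.sqrt
  rwa [Real.sqrt_one] at this

theorem tendsto_accel_plus :
    Tendsto (fun ε => foldAccel (Z ε).Mp (Z ε).up) (𝓝[>] 0) (𝓝 (b * d)) := by
  have := ((h.tendsto_Mp 0 1).mul (h.tendsto_up 1)).sub
    ((h.tendsto_Mp 1 1).mul (h.tendsto_up 0))
  simpa [foldAccel] using this

theorem tendsto_accel_minus :
    Tendsto (fun ε => foldAccel (Z ε).Mm (Z ε).um) (𝓝[>] 0) (𝓝 (-e)) := by
  have := ((h.tendsto_Mm 0 1).mul (h.tendsto_um 1)).sub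
    ((h.tendsto_Mm 1 1).mul (h.tendsto_um 0))
  simpa [foldAccel] using this

theorem eventually_pair : ∀ᶠ ε in 𝓝[>] (0 : ℝ), (Z ε).IsFocusPair := by
  have hbd : b * d < 0 := mul_neg_of_neg_of_pos h.b_neg h.d_pos
  have hdisc : 0 < -(a ^ 2 + b * c) := neg_pos.2 h.disc
  have hm1 : (!![0, -1; 1, 0] : Matrix (Fin 2) (Fin 2) ℝ) 0 1 < 0 := by simp
  filter_upwards [h.tendsto_disc_plus.eventually_const_lt hdisc,
    h.tendsto_disc_minus.eventually_const_lt one_pos,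
    (h.tendsto_Mp 0 1).eventually_lt_const h.b_neg, (h.tendsto_Mm 0 1).eventually_lt_const hm1,
    h.tendsto_accel_plus.eventually_lt_const hbd,
    h.tendsto_accel_minus.eventually_lt_const (neg_lt_zero.2 h.e_pos)]
    with ε h1 h2 h3 h4 h5 h6
  exact ⟨⟨h1, h3, h5⟩, ⟨h2, h4, h6⟩⟩

theorem tendsto_foldMinus_div :
    Tendsto (fun ε => (Z ε).foldMinus / ε) (𝓝[>] 0) (𝓝 (vm 0)) := by
  have h1 := tendsto_first_order (h.um 0)
  have h2 := (h1.div (h.tendsto_Mm 0 1) (by simp)).neg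
  simp only [Matrix.cons_val_zero, sub_zero] at h2
  convert h2 using 2
  · rw [PLField.foldMinus, foldPoint]; simp; ring
  · simp [div_neg]

theorem tendsto_foldPlus_div :
    Tendsto (fun ε => (Z ε).foldPlus / ε) (𝓝[>] 0) (𝓝 (-(vp 0 / b))) := by
  have h1 := tendsto_first_order (h.up 0)
  have h2 := (h1.div (h.tendsto_Mp 0 1) (by simpa using h.b_neg.ne)).neg
  simp only [Matrix.cons_val_zero, sub_zero] at h2
  convert h2 using 2
  · rw [PLField.foldPlus, foldPoint]; simp; ring
  · simp

theorem tendsto_foldMinus : Tendsto (fun ε => (Z ε).foldMinus) (𝓝[>] 0) (𝓝 0) := by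
  have h1 := h.tendsto_foldMinus_div.mul tendsto_self_nhdsGT
  rw [mul_zero] at h1
  refine h1.congr' ?_
  filter_upwards [self_mem_nhdsWithin] with ε (hε : 0 < ε)
  field_simp

theorem tendsto_foldPlus : Tendsto (fun ε => (Z ε).foldPlus) (𝓝[>] 0) (𝓝 0) := by
  have h1 := h.tendsto_foldPlus_div.mul tendsto_self_nhdsGT
  rw [mul_zero] at h1
  refine h1.congr' ?_
  filter_upwards [self_mem_nhdsWithin] with ε (hε : 0 < ε)
  field_simp

theorem tendsto_fold_gap_div :
    Tendsto (fun ε => ((Z ε).foldMinus - (Z ε).foldPlus) / ε) (𝓝[>] 0)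
      (𝓝 ((b * vm 0 + vp 0) / b)) := by
  have h1 := h.tendsto_foldMinus_div.sub h.tendsto_foldPlus_div
  have hb := h.b_neg.ne
  convert h1 using 2
  · ring
  · field_simp
    ring

theorem tendsto_contraction : Tendsto (fun ε => Real.exp (-(2 * |focusRate (Z ε).Mp| *
    (Real.pi / focusFreq (Z ε).Mp)))) (𝓝[>] 0) (𝓝 1) := by
  have hne : √(-(a ^ 2 + b * c)) ≠ 0 := (Real.sqrt_pos.2 (neg_pos.2 h.disc)).ne'
  have h1 := ((h.tendsto_rate_plus.abs.const_mul 2).mul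
    (tendsto_const_nhds (x := Real.pi) |>.div h.tendsto_freq_plus hne)).neg.rexp
  simpa using h1

theorem tendsto_rate_div :
    Tendsto (fun ε => focusRate (Z ε).Mm / ε) (𝓝[>] 0) (𝓝 ((Bm 0 0 + Bm 1 1) / 2)) := by
  have h1 := ((tendsto_first_order (h.Mm 0 0)).add (tendsto_first_order (h.Mm 1 1))).div_const 2
  refine h1.congr fun ε => ?_
  simp [focusRate]
  ring

theorem tendsto_rate_div_sq (hB : Bm 0 0 = -Bm 1 1) :
    Tendsto (fun ε => focusRate (Z ε).Mm / ε ^ 2) (𝓝[>] 0) (𝓝 ((Cm 0 0 + Cm 1 1) / 2)) := by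
  have h1 := ((tendsto_second_order (h.Mm 0 0)).add
    (tendsto_second_order (h.Mm 1 1))).div_const 2
  refine h1.congr fun ε => ?_
  simp [focusRate, hB]
  ring

/-- The first order trace of `Z⁻` makes excursions of `Z⁻` end at a distance of order `√ε` below the
folds, which are at a distance of order `ε`. -/
theorem eventually_isRepelling (hB : 0 < Bm 0 0 + Bm 1 1) :
    ∀ᶠ ε in 𝓝[>] (0 : ℝ), ∃ g, (Z ε).IsRepelling g := by
  have hpi := Real.pi_pos
  set R : ℝ → ℝ := fun ε => 8 * focusRate (Z ε).Mm * (foldAccel (Z ε).Mm (Z ε).um /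
    (focusRate (Z ε).Mm ^ 2 + focusFreq (Z ε).Mm ^ 2)) ^ 2 * focusFreq (Z ε).Mm / Real.pi with hR
  have h1 : Tendsto (fun ε => R ε / ε) (𝓝[>] 0)
      (𝓝 (8 * ((Bm 0 0 + Bm 1 1) / 2) * (-e / (0 ^ 2 + 1 ^ 2)) ^ 2 * 1 / Real.pi)) := by
    have := ((((h.tendsto_rate_div.const_mul 8).mul ((h.tendsto_accel_minus.div
      ((h.tendsto_rate_minus.pow 2).add (h.tendsto_freq_minus.pow 2)) (by norm_num)).pow 2)).mul
      h.tendsto_freq_minus).div_const Real.pi)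
    refine this.congr fun ε => ?_
    simp only [hR, Pi.div_apply]
    ring
  have h2 : Tendsto (fun ε => (3 * ((Z ε).Mm 0 1 * ((Z ε).foldMinus - (Z ε).foldPlus))) ^ 2 / ε)
      (𝓝[>] 0) (𝓝 0) := by
    have := ((((h.tendsto_Mm 0 1).mul h.tendsto_fold_gap_div).const_mul 3).pow 2).mul
      tendsto_self_nhdsGT
    rw [mul_zero] at this
    refine this.congr' ?_
    filter_upwards [self_mem_nhdsWithin] with ε (hε : 0 < ε)
    field_simp
  have hpos : 0 < 8 * ((Bm 0 0 + Bm 1 1) / 2) * (-e / (0 ^ 2 + 1 ^ 2)) ^ 2 * 1 / Real.pi := by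
    have := h.e_pos
    have : (0 : ℝ) < (-e / (0 ^ 2 + 1 ^ 2)) ^ 2 := by norm_num; positivity
    positivity
  filter_upwards [self_mem_nhdsWithin, h.eventually_pair,
    h.tendsto_rate_div.eventually_const_lt (half_pos hB),
    h.tendsto_contraction.eventually_const_lt (u := 1 / 2) (by norm_num),
    h2.eventually_lt h1 hpos] with ε (hε : 0 < ε) hpair hrate hcon hgap
  have hc := hpair.minus.coupling
  have hrate' : 0 < focusRate (Z ε).Mm := (div_pos_iff_of_pos_right hε).1 hrate
  have hfreq := hpair.minus.freq_pos
  have hR0 : 0 ≤ R ε := by simp only [hR]; positivity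
  have hgap' := (div_lt_div_iff_of_pos_right hε).1 hgap
  refine ⟨√(R ε) / -(Z ε).Mm 0 1, hpair, hrate', ?_, ?_, hcon.le⟩
  · rw [lt_div_iff₀ (by linarith)]
    refine Real.lt_sqrt_of_sq_lt ?_
    rw [mul_pow, mul_pow, sq_abs, neg_sq]
    rw [mul_pow, mul_pow] at hgap'
    linarith
  · have : (Z ε).Mm 0 1 * (√(R ε) / -(Z ε).Mm 0 1) = -√(R ε) := by
      have := hc.ne
      field_simp
    rw [this, neg_sq, Real.sq_sqrt hR0]

theorem eventually_no_cycle (hB : Bm 0 0 ≠ -Bm 1 1) :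
    ∀ᶠ ε in 𝓝[>] (0 : ℝ), ∀ γ : ClosedTrajectory (Z ε),
      ¬ γ.IsSlidingCycle ∧ ¬ γ.IsEscapingCycle := by
  rcases lt_or_gt_of_ne hB with hlt | hgt
  · have hB' : 0 < reverseMatrix Bm 0 0 + reverseMatrix Bm 1 1 := by
      simp [reverseMatrix]
      linarith
    filter_upwards [h.reverse.eventually_isRepelling hB'] with ε ⟨g, hg⟩ γ
    exact no_cycle_of_reverse hg.no_cycle γ
  · filter_upwards [h.eventually_isRepelling (by linarith)] with ε ⟨g, hg⟩ γ
    exact hg.no_cycle γ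

theorem eventually_up : ∀ᶠ ε in 𝓝[>] (0 : ℝ), ∀ y ∈ Icc (Z ε).foldPlus (Z ε).foldMinus,
    0 < (Z ε).plus ![0, y] 1 ∧ 0 < (Z ε).minus ![0, y] 1 := by
  have hlim : ∀ {l r y : ℝ → ℝ} {l₀ r₀ : ℝ}, Tendsto l (𝓝[>] 0) (𝓝 l₀) →
      Tendsto r (𝓝[>] 0) (𝓝 r₀) → Tendsto y (𝓝[>] 0) (𝓝 0) → 0 < r₀ →
      ∀ᶠ ε in 𝓝[>] (0 : ℝ), 0 < l ε * y ε + r ε := by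
    intro l r y l₀ r₀ hl hr hy hr0
    have := (hl.mul hy).add hr
    rw [mul_zero, zero_add] at this
    exact this.eventually_const_lt hr0
  -- an affine function that is positive at the ends of an interval is positive on it
  have haff : ∀ {l r p q y : ℝ}, 0 < l * p + r → 0 < l * q + r → y ∈ Icc p q →
      0 < l * y + r := by
    intro l r p q y h1 h2 hy
    rcases le_total 0 l with hl | hl
    · nlinarith [mul_le_mul_of_nonneg_left hy.1 hl]
    · nlinarith [mul_le_mul_of_nonpos_left hy.2 hl]
  have hd : 0 < (![0, d] : Fin 2 → ℝ) 1 := h.d_pos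
  have he : 0 < (![0, e] : Fin 2 → ℝ) 1 := h.e_pos
  filter_upwards [hlim (h.tendsto_Mp 1 1) (h.tendsto_up 1) h.tendsto_foldPlus hd,
    hlim (h.tendsto_Mp 1 1) (h.tendsto_up 1) h.tendsto_foldMinus hd,
    hlim (h.tendsto_Mm 1 1) (h.tendsto_um 1) h.tendsto_foldPlus he,
    hlim (h.tendsto_Mm 1 1) (h.tendsto_um 1) h.tendsto_foldMinus he] with ε h1 h2 h3 h4 y hy
  rw [PLField.plus, PLField.minus, affine_apply_one, affine_apply_one]
  simpa using And.intro (haff h1 h2 hy) (haff h3 h4 hy)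

/-- For a weakly unstable focus of `Z⁻` and a nonempty sliding region, the return speed of the orbit
through the fold of `Z⁻` is asymptotic to `ε e √(2 π (c₁₁⁻ + c₂₂⁻))`. -/
theorem exists_slidingPair (hB : Bm 0 0 = -Bm 1 1) (hV : b * vm 0 + vp 0 < 0)
    (hS : 0 < Cm 0 0 + Cm 1 1) :
    ∃ s : ℝ → ℝ, (∀ᶠ ε in 𝓝[>] (0 : ℝ), (Z ε).IsSlidingPair (s ε)) ∧
      Tendsto (fun ε => (Z ε).foldReturnSpeed (s ε) ^ 2 / ε ^ 2) (𝓝[>] 0)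
        (𝓝 (2 * Real.pi * (Cm 0 0 + Cm 1 1) * e ^ 2)) := by
  obtain ⟨s, hs, hlim⟩ := exists_return_angle_asymptotics
  set k : ℝ → ℝ := fun ε => focusRate (Z ε).Mm / focusFreq (Z ε).Mm with hk
  have hksq : Tendsto (fun ε => k ε / ε ^ 2) (𝓝[>] 0) (𝓝 ((Cm 0 0 + Cm 1 1) / 2)) := by
    have := (h.tendsto_rate_div_sq hB).div h.tendsto_freq_minus one_ne_zero
    rw [div_one] at this
    refine this.congr fun ε => ?_
    simp only [hk, Pi.div_apply]
    ring
  have hkpos : ∀ᶠ ε in 𝓝[>] (0 : ℝ), 0 < k ε := by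
    filter_upwards [self_mem_nhdsWithin, hksq.eventually_const_lt (half_pos hS)]
      with ε (hε : 0 < ε) h1
    exact (div_pos_iff_of_pos_right (by positivity)).1 h1
  have hk0 : Tendsto k (𝓝[>] 0) (𝓝[>] 0) := by
    refine tendsto_nhdsWithin_iff.2 ⟨?_, hkpos⟩
    have := h.tendsto_rate_minus.div h.tendsto_freq_minus one_ne_zero
    rwa [zero_div] at this
  refine ⟨fun ε => s (k ε), ?_, ?_⟩
  · have hD : 0 < (b * vm 0 + vp 0) / b := div_pos_of_neg_of_neg hV h.b_neg
    filter_upwards [self_mem_nhdsWithin, h.eventually_pair, hkpos, h.eventually_up,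
      h.tendsto_fold_gap_div.eventually_const_lt hD] with ε (hε : 0 < ε) hpair hkε hup hgap
    exact ⟨hpair, sub_pos.1 ((div_pos_iff_of_pos_right hε).1 hgap), hup, (hs _ hkε).1,
      (hs _ hkε).2⟩
  · have h1 := (((h.tendsto_accel_minus.neg.div h.tendsto_freq_minus one_ne_zero).pow 2).mul
      (hlim.comp hk0)).mul hksq
    have e1 : (- -e / 1) ^ 2 * (4 * Real.pi) * ((Cm 0 0 + Cm 1 1) / 2)
        = 2 * Real.pi * (Cm 0 0 + Cm 1 1) * e ^ 2 := by ring
    rw [e1] at h1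
    refine h1.congr' ?_
    filter_upwards [self_mem_nhdsWithin, hkpos] with ε (hε : 0 < ε) hkε
    simp only [PLField.foldReturnSpeed, Function.comp_apply, Pi.div_apply]
    change _ = (_ / _ * (Real.exp (k ε * _) * _)) ^ 2 / ε ^ 2
    field_simp

theorem tendsto_gap_speed_sq :
    Tendsto (fun ε => (-(Z ε).Mm 0 1 * ((Z ε).foldMinus - (Z ε).foldPlus)) ^ 2 / ε ^ 2) (𝓝[>] 0)
      (𝓝 (((b * vm 0 + vp 0) / b) ^ 2)) := by
  have h1 := ((h.tendsto_Mm 0 1).neg.mul h.tendsto_fold_gap_div).pow 2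
  convert h1 using 2
  · rw [← div_pow, mul_div_assoc]
  · simp

theorem eventually_sliding_typeI (hB : Bm 0 0 = -Bm 1 1) (hV : b * vm 0 + vp 0 < 0)
    (hS : 0 < Cm 0 0 + Cm 1 1)
    (hK : Cm 0 0 + Cm 1 1 < (vm 0 * b + vp 0) ^ 2 / (2 * b ^ 2 * e ^ 2 * Real.pi)) :
    ∀ᶠ ε in 𝓝[>] (0 : ℝ), ∃ γ : ClosedTrajectory (Z ε),
      γ.IsProperSlidingCycle ∧ γ.IsTypeI := by
  obtain ⟨s, hs, hlim⟩ := h.exists_slidingPair hB hV hS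
  have hb := h.b_neg
  have he := h.e_pos
  have hpi := Real.pi_pos
  have hlt : 2 * Real.pi * (Cm 0 0 + Cm 1 1) * e ^ 2 < ((b * vm 0 + vp 0) / b) ^ 2 := by
    have hb2 : 0 < b ^ 2 := by nlinarith
    have hden : 0 < 2 * b ^ 2 * e ^ 2 * Real.pi := by positivity
    rw [lt_div_iff₀ hden] at hK
    rw [div_pow, lt_div_iff₀ hb2]
    linarith
  have hpos : ∀ᶠ ε in 𝓝[>] (0 : ℝ),
      0 ≤ -(Z ε).Mm 0 1 * ((Z ε).foldMinus - (Z ε).foldPlus) := hs.mono fun ε hε =>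
    mul_nonneg (by linarith [hε.pair.minus.coupling]) (by linarith [hε.lt])
  filter_upwards [hs, eventually_lt_of_sq_div hlim h.tendsto_gap_speed_sq hlt hpos] with ε h1 h2
  exact h1.exists_typeI h2

theorem eventually_sliding_typeII (hB : Bm 0 0 = -Bm 1 1) (hV : b * vm 0 + vp 0 < 0)
    (hK : (vm 0 * b + vp 0) ^ 2 / (2 * b ^ 2 * e ^ 2 * Real.pi) < Cm 0 0 + Cm 1 1)
    (hK' : Cm 0 0 + Cm 1 1 < 2 * (vm 0 * b + vp 0) ^ 2 / (b ^ 2 * e ^ 2 * Real.pi)) :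
    ∀ᶠ ε in 𝓝[>] (0 : ℝ), ∃ γ : ClosedTrajectory (Z ε),
      γ.IsProperSlidingCycle ∧ γ.IsTypeII := by
  have hb := h.b_neg
  have he := h.e_pos
  have hpi := Real.pi_pos
  have hb2 : 0 < b ^ 2 := by nlinarith
  have hS : 0 < Cm 0 0 + Cm 1 1 := lt_of_le_of_lt (by positivity) hK
  obtain ⟨s, hs, hlim⟩ := h.exists_slidingPair hB hV hS
  have hlt : ((b * vm 0 + vp 0) / b) ^ 2 < 2 * Real.pi * (Cm 0 0 + Cm 1 1) * e ^ 2 := by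
    rw [div_lt_iff₀ (by positivity)] at hK
    rw [div_pow, div_lt_iff₀ hb2]
    linarith
  have hlt' : 2 * Real.pi * (Cm 0 0 + Cm 1 1) * e ^ 2 <
      ((b * vm 0 + vp 0) / b) ^ 2 * (1 + 1) ^ 2 := by
    rw [lt_div_iff₀ (by positivity)] at hK'
    rw [div_pow, div_mul_eq_mul_div, lt_div_iff₀ hb2]
    linarith
  have hlim' : Tendsto (fun ε => (-(Z ε).Mm 0 1 * ((Z ε).foldMinus - (Z ε).foldPlus) *
      (1 + Real.exp (-(2 * |focusRate (Z ε).Mp| * (Real.pi / focusFreq (Z ε).Mp))))) ^ 2 / ε ^ 2)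
      (𝓝[>] 0) (𝓝 (((b * vm 0 + vp 0) / b) ^ 2 * (1 + 1) ^ 2)) := by
    refine (h.tendsto_gap_speed_sq.mul ((h.tendsto_contraction.const_add 1).pow 2)).congr
      fun ε => ?_
    ring
  have hpos : ∀ᶠ ε in 𝓝[>] (0 : ℝ),
      0 ≤ -(Z ε).Mm 0 1 * ((Z ε).foldMinus - (Z ε).foldPlus) := hs.mono fun ε hε =>
    mul_nonneg (by linarith [hε.pair.minus.coupling]) (by linarith [hε.lt])
  filter_upwards [hs,
    eventually_lt_of_sq_div h.tendsto_gap_speed_sq hlim hlt (hs.mono fun ε hε => hε.speed_pos.le),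
    eventually_lt_of_sq_div hlim hlim' hlt' (hpos.mono fun ε hε => mul_nonneg hε (by positivity))]
    with ε h1 h2 h3
  exact h1.exists_typeII h2 h3

end PerturbedCenter

theorem mainTheorem2
    (a b c d e : ℝ)
    (hb : b < 0) (hc : 0 < c) (hd : 0 < d) (he : 0 < e) (habc : a ^ 2 + b * c < 0)
    (Bp Bm Cp Cm : Matrix (Fin 2) (Fin 2) ℝ) (vp vm wp wm : Fin 2 → ℝ)
    (Z : ℝ → PLField)
    (hMp : MatrixExpansion (fun ε => (Z ε).Mp) !![a, b; c, -a] Bp Cp)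
    (hup : VectorExpansion (fun ε => (Z ε).up) ![0, d] vp wp)
    (hMm : MatrixExpansion (fun ε => (Z ε).Mm) !![0, -1; 1, 0] Bm Cm)
    (hum : VectorExpansion (fun ε => (Z ε).um) ![0, e] vm wm) :
    -- (1) sliding cycles
    (Bm 0 0 = -Bm 1 1 → b * vm 0 + vp 0 < 0 → 0 < a → a < d + b * e →
      (0 < Cm 0 0 + Cm 1 1 →
        Cm 0 0 + Cm 1 1 < (vm 0 * b + vp 0) ^ 2 / (2 * b ^ 2 * e ^ 2 * Real.pi) →
        ∀ᶠ ε in 𝓝[>] (0 : ℝ), ∃ γ : ClosedTrajectory (Z ε),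
          γ.IsProperSlidingCycle ∧ γ.IsTypeI) ∧
      ((vm 0 * b + vp 0) ^ 2 / (2 * b ^ 2 * e ^ 2 * Real.pi) < Cm 0 0 + Cm 1 1 →
        Cm 0 0 + Cm 1 1 < 2 * (vm 0 * b + vp 0) ^ 2 / (b ^ 2 * e ^ 2 * Real.pi) →
        ∀ᶠ ε in 𝓝[>] (0 : ℝ), ∃ γ : ClosedTrajectory (Z ε),
          γ.IsProperSlidingCycle ∧ γ.IsTypeII)) ∧
    -- (2) escaping cycles
    (Bm 0 0 = -Bm 1 1 → 0 < b * vm 0 + vp 0 → a < 0 → 0 < d + b * e →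
      (-((vm 0 * b + vp 0) ^ 2 / (2 * b ^ 2 * e ^ 2 * Real.pi)) < Cm 0 0 + Cm 1 1 →
        Cm 0 0 + Cm 1 1 < 0 →
        ∀ᶠ ε in 𝓝[>] (0 : ℝ), ∃ γ : ClosedTrajectory (Z ε),
          γ.IsProperEscapingCycle ∧ γ.IsTypeI) ∧
      (-(2 * (vm 0 * b + vp 0) ^ 2 / (b ^ 2 * e ^ 2 * Real.pi)) < Cm 0 0 + Cm 1 1 →
        Cm 0 0 + Cm 1 1 < -((vm 0 * b + vp 0) ^ 2 / (2 * b ^ 2 * e ^ 2 * Real.pi)) →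
        ∀ᶠ ε in 𝓝[>] (0 : ℝ), ∃ γ : ClosedTrajectory (Z ε),
          γ.IsProperEscapingCycle ∧ γ.IsTypeII)) ∧
    -- (3) no sliding (or escaping) cycle
    (Bm 0 0 ≠ -Bm 1 1 →
      ∀ᶠ ε in 𝓝[>] (0 : ℝ), ∀ γ : ClosedTrajectory (Z ε),
        ¬ γ.IsSlidingCycle ∧ ¬ γ.IsEscapingCycle) := by
  have h : PerturbedCenter a b c d e Bp Bm Cp Cm vp vm wp wm Z :=
    ⟨hb, hd, he, habc, hMp, hup, hMm, hum⟩
  have hsq : (reverseVector vm 0 * b + reverseVector vp 0) ^ 2 = (vm 0 * b + vp 0) ^ 2 := by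
    simp [reverseVector]
    ring
  have htr : reverseMatrix Cm 0 0 + reverseMatrix Cm 1 1 = -(Cm 0 0 + Cm 1 1) := by
    simp [reverseMatrix]
    ring
  have hrB : Bm 0 0 = -Bm 1 1 → reverseMatrix Bm 0 0 = -reverseMatrix Bm 1 1 := fun hB => by
    simp [reverseMatrix, hB]
  have hrV : 0 < b * vm 0 + vp 0 → b * reverseVector vm 0 + reverseVector vp 0 < 0 := fun hV => by
    simp [reverseVector]
    linarith
  refine ⟨fun hB hV _ _ => ⟨h.eventually_sliding_typeI hB hV, h.eventually_sliding_typeII hB hV⟩,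
    fun hB hV _ _ => ⟨fun hK hS => ?_, fun hK' hK => ?_⟩, h.eventually_no_cycle⟩
  · filter_upwards [h.reverse.eventually_sliding_typeI (hrB hB) (hrV hV) (by linarith)
      (by rw [hsq]; linarith)] with ε hε
    exact exists_escaping_of_reverse ClosedTrajectory.IsTypeI.reverse hε
  · filter_upwards [h.reverse.eventually_sliding_typeII (hrB hB) (hrV hV)
      (by rw [hsq]; linarith) (by rw [hsq]; linarith)] with ε hε
    exact exists_escaping_of_reverse ClosedTrajectory.IsTypeII.reverse hε
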